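/- An odd Durfee symbol of an integer $n\ge 0$ is a triple consisting of an integer $D\ge 0$ and two (possibly empty) rows $a_1\ge a_2\ge\cdots\ge a_s$ and $b_1\ge b_2\ge\cdots\ge b_t$ of odd positive integers, all at most $2D+1$, such that $n=\sum_{i=1}^s a_i+\sum_{j=1}^t b_j+2D^2+2D+1$. Its odd rank is $s-t$. Let $N^0(a,M;n)$ be the number of odd Durfee symbols of $n$ whose odd rank is congruent to $a$ modulo $M$. For complex numbers $a,x,q$ with $|q|<1$ put $$(a;q)_n=\prod_{k=0}^{n-1}(1-aq^k),\qquad (a;q)_\infty=\prod_{k=0}^{\infty}(1-aq^k),\qquad J_m=(q^m;q^m)_\infty\quad (m\ge 1),$$ $$g(x;q)=x^{-1}\left(-1+\sum_{n=0}^{\infty}\frac{q^{n^2}}{(x;q)_{n+1}(q/x;q)_n}\right)$$ (for $x\neq 0$ such that no denominator vanishes). **Theorem.** Let $q$ be a complex number with $|q|<1$. Then the following series converge absolutely and have the stated sums, where in (2) and (3) it is also assumed that $q\ne 0$: 1. $\displaystyle\sum_{n=0}^{\infty}\bigl(N^0(0,8;8n+1)-N^0(4,8;8n+1)\bigr)q^n=\frac{J_2^4}{J_1^2J_4}$;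 2. $\displaystyle\sum_{n=0}^{\infty}\bigl(N^0(0,8;8n+3)-N^0(4,8;8n+3)\bigr)q^n=\frac{J_4^3}{J_2^2}+q\,g(q^2;q^4)$; 3. $\displaystyle\sum_{n=0}^{\infty}\bigl(N^0(1,8;8n)-N^0(3,8;8n)\bigr)q^n=q\,g(q;q^4)$; 4. $\displaystyle\sum_{n=0}^{\infty}\bigl(N^0(1,8;8n+2)-N^0(3,8;8n+2)\bigr)q^n=\frac{J_2J_4}{J_1}$. -/

import Mathlib

/-- An odd Durfee symbol of `n`: a top row `a₁ ≥ a₂ ≥ ⋯ ≥ aₛ`, a bottom row `b₁ ≥ b₂ ≥ ⋯ ≥ bₜ`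
(either row may be empty) and a subscript `D`, where all entries are odd natural numbers that are at
most `2D + 1`, and the sum of all entries plus `2D² + 2D + 1` is `n`. -/
@[ext]
structure OddDurfeeSymbol (n : ℕ) where
  top : List ℕ
  bot : List ℕ
  D : ℕ
  top_pairwise : top.Pairwise (fun a b => a ≥ b)
  bot_pairwise : bot.Pairwise (fun a b => a ≥ b)
  top_mem : ∀ a ∈ top, Odd a ∧ a ≤ 2 * D + 1
  bot_mem : ∀ b ∈ bot, Odd b ∧ b ≤ 2 * D + 1
  sum_eq : top.sum + bot.sum + (2 * D ^ 2 + 2 * D + 1) = n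

/-- The odd rank: number of entries in the top row minus number of entries in the bottom row. -/
def OddDurfeeSymbol.oddRank {n : ℕ} (s : OddDurfeeSymbol n) : ℤ :=
  (s.top.length : ℤ) - (s.bot.length : ℤ)

/-- There are only finitely many odd Durfee symbols of `n`, so that they can be counted
by `Nat.card`. -/
instance OddDurfeeSymbol.instFinite (n : ℕ) : Finite (OddDurfeeSymbol n) := by
  have key : ∀ l : List ℕ, (∀ a ∈ l, Odd a) → l.length ≤ l.sum := by
    intro l hl
    have := List.card_nsmul_le_sum l 1 (fun a ha => (hl a ha).pos)
    simpa using this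
  have hfin : Set.Finite {l : List (Fin (n + 1)) | l.length ≤ n} :=
    List.finite_length_le (Fin (n + 1)) n
  have hfin' : Set.Finite {l : List ℕ | l.length ≤ n ∧ ∀ a ∈ l, a ≤ n} := by
    refine (hfin.image (List.map Fin.val)).subset ?_
    rintro l ⟨hl, hm⟩
    refine ⟨l.map (fun a => Fin.ofNat (n + 1) a), by simpa using hl, ?_⟩
    rw [List.map_map]
    conv_rhs => rw [← List.map_id l]
    refine List.map_congr_left fun a ha => ?_
    have := hm a ha
    simp [Fin.ofNat, Nat.mod_eq_of_lt (Nat.lt_succ_of_le this)]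
  have hall := (hfin'.prod hfin').prod (Set.finite_Iic n)
  have := hall.to_subtype
  refine Finite.of_injective
    (β := ↥(({l : List ℕ | l.length ≤ n ∧ ∀ a ∈ l, a ≤ n} ×ˢ
      {l : List ℕ | l.length ≤ n ∧ ∀ a ∈ l, a ≤ n}) ×ˢ Set.Iic n))
    (fun s => ⟨((s.top, s.bot), s.D), ?_⟩) ?_
  · have h := s.sum_eq
    have h1 := key s.top fun a ha => (s.top_mem a ha).1
    have h2 := key s.bot fun a ha => (s.bot_mem a ha).1
    refine ⟨⟨⟨by dsimp only; omega, fun a ha => ?_⟩, ⟨by dsimp only; omega, fun a ha => ?_⟩⟩, ?_⟩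
    · have := List.le_sum_of_mem ha
      dsimp only at this
      omega
    · have := List.le_sum_of_mem ha
      dsimp only at this
      omega
    · simp only [Set.mem_Iic]
      omega
  · intro s t hst
    have hst := congrArg Subtype.val hst
    simp only [Prod.mk.injEq] at hst
    exact OddDurfeeSymbol.ext hst.1.1 hst.1.2 hst.2

/-- `N⁰(a, M; n)`: the number of odd Durfee symbols of `n` with odd rank congruent to `a`
modulo `M`. -/
noncomputable def oddRankCount (a : ℤ) (M : ℕ) (n : ℕ) : ℕ :=
  Nat.card {s : OddDurfeeSymbol n // s.oddRank ≡ a [ZMOD (M : ℤ)]}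

/-- The finite `q`-Pochhammer symbol `(a; q)ₙ = ∏_{k=0}^{n-1} (1 - a q ^ k)`. -/
noncomputable def qPoch (a q : ℂ) (n : ℕ) : ℂ :=
  ∏ k ∈ Finset.range n, (1 - a * q ^ k)

/-- The infinite `q`-Pochhammer symbol `(a; q)_∞ = ∏_{k=0}^∞ (1 - a q ^ k)`, for `|q| < 1`. -/
noncomputable def qPochInf (a q : ℂ) : ℂ :=
  ∏' k : ℕ, (1 - a * q ^ k)

/-- `J_m = (q ^ m; q ^ m)_∞` as a function of `q`. -/
noncomputable def eulerJ (m : ℕ) (q : ℂ) : ℂ :=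
  qPochInf (q ^ m) (q ^ m)

/-- The universal mock theta function
`g(x; q) = x⁻¹ (-1 + ∑_{n ≥ 0} q ^ (n ^ 2) / ((x; q)_{n+1} (q / x; q)_n))`. -/
noncomputable def mockG (x q : ℂ) : ℂ :=
  x⁻¹ * (-1 + ∑' n : ℕ, q ^ (n ^ 2) / (qPoch x q (n + 1) * qPoch (q / x) q n))

/-! For a fixed subscript `D`, each row contributes a product of geometric series, one for each odd
part size. Weighting symbols by `z ^ rank * w ^ n` and summing over `D` therefore gives a basic
hypergeometric series in base `w ^ 2` at `x = z * w`. Expanding its terms in partial fractions and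
summing over `D` by Cauchy's identity turns it into a level three Appell sum (`hasSum_appellSum`,
`hasSum_oddRank`). The same computation, after a telescoping, turns `mockG` into an Appell sum
(`mockG_eq_appellSum`).

Take `z` a primitive eighth root of unity with `z ^ 2 = I`. The value of `z ^ rank` remembers the
rank modulo 8, and the symmetry under interchange of rows leaves exactly the two differences of the
theorem (`tsum_eighth_root_oddRank`). On the analytic side, writing `1 / (1 - u) = (1 + u) / (1 - u
^ 2)` splits the Appell sum into two sums with denominators `1 - X * q ^ (2 k)`. The key is
`evenAppellSum_div`: the product of the partial fraction expansions of two reciprocal theta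
functions, in bases `q ^ 2` and `q ^ 4`, expresses such a sum by a theta quotient and an Appell sum
in base `q ^ 4`. Applying it twice at special points, together with the dissection of the theta
series of squares, leaves only eta-type products and mock theta values in powers of `w ^ 8`, times
explicit powers of `w` (`mul_appellSum_eighth_root`).

Averaging over `w ↦ z ^ j * w` then isolates each exponent class modulo 8 (`hasSum_residue_class`).
The odd rank and `n` have opposite parity, so in each class only one of the two differences
survives. -/

section

open Filter Topology

/-! ### Triangular exponents and `q`-Pochhammer symbols. -/

/-- The triangular number `k (k + 1) / 2` of an integer `k`. -/
def tri (k : ℤ) : ℤ := k * (k + 1) / 2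

theorem two_mul_tri (k : ℤ) : 2 * tri k = k * (k + 1) :=
  Int.mul_ediv_cancel' (Int.even_mul_succ_self k).two_dvd

theorem tri_add_one (k : ℤ) : tri (k + 1) = tri k + (k + 1) := by
  have h1 := two_mul_tri k
  have h2 := two_mul_tri (k + 1)
  linarith

theorem tri_reflect (k : ℤ) : tri (-1 - k) = tri k := by
  have h1 := two_mul_tri k
  have h2 := two_mul_tri (-1 - k)
  linarith

theorem tri_neg (k : ℤ) : tri (-k) = tri k - k := by
  have h1 := two_mul_tri k
  have h2 := two_mul_tri (-k)
  linarith

theorem tri_zero : tri 0 = 0 := rfl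

theorem tri_two_mul (k : ℤ) : tri (2 * k) = 2 * k ^ 2 + k := by
  have h1 := two_mul_tri (2 * k)
  linarith

theorem tri_nonneg (k : ℤ) : 0 ≤ tri k := by
  have h := two_mul_tri k
  rcases le_or_gt 0 k with h0 | h0 <;> nlinarith

theorem summable_pow_tri_nat {ρ r : ℝ} (hρ0 : 0 < ρ) (hρ : ρ < 1) (hr : 0 < r) :
    Summable fun n : ℕ => ρ ^ tri n * r ^ n := by
  refine summable_of_ratio_test_tendsto_lt_one (l := 0) one_pos (.of_forall fun n => ?_) ?_
  · positivity
  · have h : ∀ n : ℕ, ‖ρ ^ tri (n + 1 : ℕ) * r ^ (n + 1)‖ / ‖ρ ^ tri n * r ^ n‖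
        = ρ * r * ρ ^ n := by
      intro n
      rw [Real.norm_of_nonneg (by positivity), Real.norm_of_nonneg (by positivity)]
      push_cast
      rw [tri_add_one, zpow_add₀ hρ0.ne', zpow_add₀ hρ0.ne', zpow_natCast]
      field_simp
      ring
    simp only [h]
    simpa using (tendsto_pow_atTop_nhds_zero_of_lt_one hρ0.le hρ).const_mul (ρ * r)

theorem summable_zpow_tri {ρ r : ℝ} (hρ0 : 0 < ρ) (hρ : ρ < 1) (hr : 0 < r) :
    Summable fun k : ℤ => ρ ^ tri k * r ^ k := by
  refine Summable.of_nat_of_neg ?_ ?_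
  · simpa using summable_pow_tri_nat hρ0 hρ hr
  · have := summable_pow_tri_nat hρ0 hρ (r := ρ⁻¹ * r⁻¹) (by positivity)
    refine this.congr fun n => ?_
    rw [tri_neg, zpow_sub₀ hρ0.ne', zpow_neg, zpow_natCast, zpow_natCast, mul_pow, inv_pow, inv_pow]
    ring

/-- The signed weight `(-1) ^ k q ^ (k (k + 1) / 2)`. -/
noncomputable def triWeight (q : ℂ) (k : ℤ) : ℂ := (-1) ^ k * q ^ tri k

theorem norm_neg_one_zpow (k : ℤ) : ‖(-1 : ℂ) ^ k‖ = 1 := by simp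

theorem norm_triWeight (q : ℂ) (k : ℤ) : ‖triWeight q k‖ = ‖q‖ ^ tri k := by
  simp [triWeight]

theorem triWeight_reflect (q : ℂ) (k : ℤ) : triWeight q (-1 - k) = - triWeight q k := by
  have : ((-1 : ℂ)) ^ (-1 - k) = - (-1) ^ k := by
    rw [zpow_sub₀ (by norm_num)]
    rcases Int.even_or_odd k with h | h <;> simp [h.neg_one_zpow]
  rw [triWeight, triWeight, tri_reflect, this]
  ring

theorem triWeight_add_one {q : ℂ} (hq0 : q ≠ 0) (k : ℤ) :
    triWeight q (k + 1) = - triWeight q k * q ^ (k + 1) := by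
  rw [triWeight, triWeight, tri_add_one, zpow_add₀ hq0, zpow_add₀ (by norm_num : (-1 : ℂ) ≠ 0)]
  simp
  ring

theorem summable_norm_triWeight {q : ℂ} (hq0 : q ≠ 0) (hq : ‖q‖ < 1) :
    Summable fun k : ℤ => ‖triWeight q k‖ := by
  simpa [norm_triWeight] using summable_zpow_tri (norm_pos_iff.2 hq0) hq one_pos

theorem pow_ne_one_of_norm_lt_one {q : ℂ} (hq : ‖q‖ < 1) {n : ℕ} (hn : n ≠ 0) : q ^ n ≠ 1 := by
  intro h
  have := congrArg norm h
  rw [norm_pow, norm_one] at this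
  exact (pow_lt_one₀ (norm_nonneg q) hq hn).ne this

theorem zpow_ne_one_of_norm_lt_one {q : ℂ} (hq : ‖q‖ < 1) {n : ℤ} (hn : n ≠ 0) :
    q ^ n ≠ 1 := by
  intro h
  have h1 := congrArg norm h
  rw [norm_zpow, norm_one] at h1
  exact hn ((zpow_eq_one_iff_right₀ (norm_nonneg q) hq.ne).1 h1)

theorem qPoch_zero (a q : ℂ) : qPoch a q 0 = 1 := by simp [qPoch]

theorem qPoch_succ (a q : ℂ) (n : ℕ) : qPoch a q (n + 1) = qPoch a q n * (1 - a * q ^ n) :=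
  Finset.prod_range_succ _ _

theorem qPoch_succ' (a q : ℂ) (n : ℕ) : qPoch a q (n + 1) = (1 - a) * qPoch (a * q) q n := by
  rw [qPoch, Finset.prod_range_succ', qPoch, mul_comm]
  simp only [pow_succ, pow_zero, mul_one]
  congr 1
  exact Finset.prod_congr rfl fun k _ => by ring

theorem qPoch_self_ne_zero {q : ℂ} (hq : ‖q‖ < 1) (n : ℕ) : qPoch q q n ≠ 0 := by
  refine Finset.prod_ne_zero_iff.2 fun k _ => ?_
  rw [← pow_succ', sub_ne_zero]
  exact (pow_ne_one_of_norm_lt_one hq k.succ_ne_zero).symm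

theorem summable_norm_geometric {q : ℂ} (hq : ‖q‖ < 1) (a : ℂ) :
    Summable fun k : ℕ => ‖-(a * q ^ k)‖ := by
  simp only [norm_neg, norm_mul, norm_pow]
  exact (summable_geometric_of_lt_one (norm_nonneg q) hq).mul_left _

theorem multipliable_qPochInf {q : ℂ} (hq : ‖q‖ < 1) (a : ℂ) :
    Multipliable fun k : ℕ => 1 - a * q ^ k := by
  simpa [sub_eq_add_neg] using multipliable_one_add_of_summable (summable_norm_geometric hq a)

theorem tendsto_qPoch {q : ℂ} (hq : ‖q‖ < 1) (a : ℂ) :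
    Tendsto (qPoch a q) atTop (𝓝 (qPochInf a q)) :=
  (multipliable_qPochInf hq a).hasProd.tendsto_prod_nat

theorem qPochInf_ne_zero {a q : ℂ} (hq : ‖q‖ < 1) (h : ∀ k : ℕ, a * q ^ k ≠ 1) :
    qPochInf a q ≠ 0 := by
  have := tprod_one_add_ne_zero_of_summable (f := fun k : ℕ => -(a * q ^ k))
    (fun k => by rw [← sub_eq_add_neg, sub_ne_zero]; exact (h k).symm) (summable_norm_geometric hq a)
  simpa [qPochInf, sub_eq_add_neg] using this

theorem qPochInf_self_ne_zero {q : ℂ} (hq : ‖q‖ < 1) : qPochInf q q ≠ 0 :=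
  qPochInf_ne_zero hq fun k => by
    rw [← pow_succ']
    exact pow_ne_one_of_norm_lt_one hq k.succ_ne_zero

theorem qPochInf_step {q : ℂ} (hq : ‖q‖ < 1) (a : ℂ) :
    qPochInf a q = (1 - a) * qPochInf (a * q) q := by
  refine tendsto_nhds_unique ((tendsto_qPoch hq a).comp (tendsto_add_atTop_nat 1)) ?_
  simp only [Function.comp_def, qPoch_succ']
  exact (tendsto_qPoch hq _).const_mul _

theorem qPochInf_even_odd {q : ℂ} (hq : ‖q‖ < 1) (a : ℂ) :
    qPochInf a q = qPochInf a (q ^ 2) * qPochInf (a * q) (q ^ 2) := by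
  have hq2 : ‖q ^ 2‖ < 1 := by
    rw [norm_pow]; exact pow_lt_one₀ (norm_nonneg q) hq two_ne_zero
  have h2 : Tendsto (fun n : ℕ => 2 * n) atTop atTop :=
    tendsto_id.const_mul_atTop' (by norm_num)
  refine tendsto_nhds_unique ((tendsto_qPoch hq a).comp h2) ?_
  refine ((tendsto_qPoch hq2 a).mul (tendsto_qPoch hq2 (a * q))).congr fun n => ?_
  induction n with
  | zero => simp [qPoch]
  | succ n ih =>
    simp only [Function.comp_apply] at ih ⊢
    rw [show 2 * (n + 1) = 2 * n + 1 + 1 by ring, qPoch_succ a q, qPoch_succ a q, ← ih,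
      qPoch_succ, qPoch_succ]
    ring

theorem qPochInf_mul_neg {q : ℂ} (hq : ‖q‖ < 1) (a : ℂ) :
    qPochInf a q * qPochInf (-a) q = qPochInf (a ^ 2) (q ^ 2) := by
  have hq2 : ‖q ^ 2‖ < 1 := by
    rw [norm_pow]; exact pow_lt_one₀ (norm_nonneg q) hq two_ne_zero
  refine tendsto_nhds_unique ((tendsto_qPoch hq a).mul (tendsto_qPoch hq (-a))) ?_
  refine (tendsto_qPoch hq2 (a ^ 2)).congr fun n => ?_
  rw [qPoch, qPoch, qPoch, ← Finset.prod_mul_distrib]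
  exact Finset.prod_congr rfl fun k _ => by ring

theorem HasSum.of_eq {ι : Type*} {f g : ι → ℂ} {a b : ℂ} (h : HasSum f a) (hf : ∀ i, g i = f i)
    (hb : b = a) : HasSum g b := by
  rwa [hb, funext hf]

theorem exists_norm_le_of_tendsto {u : ℕ → ℂ} {l : ℂ} (h : Tendsto u atTop (𝓝 l)) :
    ∃ B : ℝ, 0 ≤ B ∧ ∀ n, ‖u n‖ ≤ B := by
  obtain ⟨B, hB⟩ := (Metric.isBounded_range_of_tendsto u h).exists_norm_le
  exact ⟨B, (norm_nonneg _).trans (hB _ ⟨0, rfl⟩), fun n => hB _ ⟨n, rfl⟩⟩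

/-! ### Reciprocal Pochhammer symbols over the integers and finite partial fractions. -/

/-- The reciprocal `1 / (q; q)ₙ`, extended by zero to negative integers `n`. -/
noncomputable def invPoch (q : ℂ) (n : ℤ) : ℂ := if 0 ≤ n then (qPoch q q n.toNat)⁻¹ else 0

theorem invPoch_natCast (q : ℂ) (n : ℕ) : invPoch q n = (qPoch q q n)⁻¹ := by simp [invPoch]

theorem invPoch_of_neg (q : ℂ) {n : ℤ} (hn : n < 0) : invPoch q n = 0 := by
  simp [invPoch, hn]

theorem invPoch_zero (q : ℂ) : invPoch q 0 = 1 := by simp [invPoch, qPoch]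

/-- Holding for every integer `n`, also at `n = 0` where both sides vanish, this recurrence lets
finite sums be treated as sums over all of `ℤ` without boundary terms. -/
theorem invPoch_sub_one {q : ℂ} (hq : ‖q‖ < 1) (n : ℤ) :
    invPoch q (n - 1) = (1 - q ^ n) * invPoch q n := by
  rcases lt_trichotomy n 0 with h | rfl | h
  · rw [invPoch_of_neg q h, invPoch_of_neg q (by omega), mul_zero]
  · rw [invPoch_of_neg q (by omega)]; simp
  · obtain ⟨m, rfl⟩ : ∃ m : ℕ, n = m + 1 := ⟨(n - 1).toNat, by omega⟩
    rw [add_sub_cancel_right, invPoch_natCast, ← Nat.cast_succ, invPoch_natCast, zpow_natCast,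
      qPoch_succ, ← pow_succ']
    have h1 := qPoch_self_ne_zero hq m
    have h2 : 1 - q ^ (m + 1) ≠ 0 :=
      sub_ne_zero.2 (pow_ne_one_of_norm_lt_one hq m.succ_ne_zero).symm
    field_simp

theorem exists_norm_invPoch_le {q : ℂ} (hq : ‖q‖ < 1) :
    ∃ B : ℝ, 0 ≤ B ∧ ∀ n, ‖invPoch q n‖ ≤ B := by
  obtain ⟨B, hB0, hB⟩ := exists_norm_le_of_tendsto
    ((tendsto_qPoch hq q).inv₀ (qPochInf_self_ne_zero hq))
  refine ⟨B, hB0, fun n => ?_⟩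
  rw [invPoch]
  split_ifs
  · exact hB _
  · simpa using hB0

theorem tendsto_invPoch_atTop {q : ℂ} (hq : ‖q‖ < 1) :
    Tendsto (invPoch q) atTop (𝓝 (qPochInf q q)⁻¹) := by
  have h := ((tendsto_qPoch hq q).inv₀ (qPochInf_self_ne_zero hq)).comp
    (tendsto_atTop_atTop.2 fun b : ℕ => ⟨(b : ℤ), fun a (ha : (b : ℤ) ≤ a) => (by omega : b ≤ a.toNat)⟩ :
      Tendsto Int.toNat atTop atTop)
  refine h.congr' ?_
  filter_upwards [eventually_ge_atTop 0] with n hn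
  simp [invPoch, hn]

/-- The inverse tends to 1 as `k → +∞` and to 0 as `k → -∞`. At a pole it has the junk value 0, so
poles need not be avoided. -/
theorem exists_norm_inv_one_sub_le {x q : ℂ} (hx0 : x ≠ 0) (hq0 : q ≠ 0) (hq : ‖q‖ < 1) :
    ∃ B : ℝ, 0 ≤ B ∧ ∀ k : ℤ, ‖(1 - x * q ^ k)⁻¹‖ ≤ B := by
  have h1 : Tendsto (fun n : ℕ => (1 - x * q ^ n)⁻¹) atTop (𝓝 (1 - x * 0)⁻¹) :=
    ((tendsto_const_nhds.mul (tendsto_pow_atTop_nhds_zero_of_norm_lt_one hq)).const_sub 1).inv₀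
      (by simp)
  have h2 : Tendsto (fun n : ℕ => x⁻¹ * q ^ n * (x⁻¹ * q ^ n - 1)⁻¹) atTop
      (𝓝 (x⁻¹ * 0 * (x⁻¹ * 0 - 1)⁻¹)) := by
    have h := (tendsto_const_nhds (x := x⁻¹)).mul (tendsto_pow_atTop_nhds_zero_of_norm_lt_one hq)
    exact h.mul ((h.sub_const 1).inv₀ (by simp))
  obtain ⟨B1, hB1, h1⟩ := exists_norm_le_of_tendsto h1
  obtain ⟨B2, hB2, h2⟩ := exists_norm_le_of_tendsto h2
  refine ⟨max B1 B2, le_max_of_le_left hB1, fun k => ?_⟩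
  obtain ⟨n, rfl | rfl⟩ := k.eq_nat_or_neg
  · exact (h1 n).trans (le_max_left _ _)
  · refine le_trans (le_of_eq ?_) ((h2 n).trans (le_max_right _ _))
    congr 1
    have hqn : q ^ n ≠ 0 := pow_ne_zero _ hq0
    rw [zpow_neg, zpow_natCast]
    rw [show 1 - x * (q ^ n)⁻¹ = (x⁻¹ * q ^ n - 1) * (x * (q ^ n)⁻¹) by field_simp, mul_inv, mul_inv,
      inv_inv, mul_comm]

theorem triWeight_ne_zero {q : ℂ} (hq0 : q ≠ 0) (k : ℤ) : triWeight q k ≠ 0 := by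
  simp [triWeight, zpow_ne_zero, hq0]

theorem qPoch_zpow_neg {q : ℂ} (hq0 : q ≠ 0) (n : ℕ) :
    qPoch (q ^ (-n : ℤ)) q n * triWeight q n = qPoch q q n := by
  induction n with
  | zero => simp [qPoch, triWeight, tri_zero]
  | succ n ih =>
    rw [qPoch_succ', qPoch_succ, ← ih, Nat.cast_succ, triWeight_add_one hq0,
      show q ^ (-((n : ℤ) + 1)) * q = q ^ (-n : ℤ) by
        rw [← zpow_add_one₀ hq0]; congr 1; ring]
    rw [zpow_neg, ← Nat.cast_succ, zpow_natCast, pow_succ]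
    field_simp
    ring

theorem qPoch_pow_succ_mul (q : ℂ) (N M : ℕ) :
    qPoch q q N * qPoch (q ^ (N + 1)) q M = qPoch q q (N + M) := by
  induction M with
  | zero => simp [qPoch_zero]
  | succ M ih => rw [qPoch_succ, ← mul_assoc, ih, ← add_assoc, qPoch_succ]; ring

/-- Induction on `M`. Before dividing by the new factor `1 - x * q ^ (M + 1)`, the value of the old
expansion at its zero `x = q ^ (-(M + 1))` is subtracted, so that the quotient has no new pole; the
subtracted value is the coefficient of the new partial fraction. -/
theorem hasSum_partialFraction_top {q : ℂ} (hq0 : q ≠ 0) (hq : ‖q‖ < 1) (M : ℕ) :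
    ∀ x : ℂ, x ≠ 0 → (∀ k : ℤ, 0 ≤ k → k ≤ M → x * q ^ k ≠ 1) →
    HasSum (fun k : ℤ => triWeight q k * invPoch q (M - k) * invPoch q k / (1 - x * q ^ k))
      (1 / qPoch x q (M + 1)) := by
  induction M with
  | zero =>
    intro x _ _
    refine (hasSum_single (0 : ℤ) ?_).of_eq (fun _ => rfl) ?_
    rotate_left
    · simp [qPoch, triWeight, tri_zero, invPoch_zero]
    · intro k hk
      rcases lt_or_gt_of_ne hk with h | h
      · rw [invPoch_of_neg q h]; simp
      · rw [invPoch_of_neg q (n := ((0 : ℕ) : ℤ) - k) (by push_cast; omega)]; simp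
  | succ M ih =>
    intro x hx0 hx
    have hv : 1 - x * q ^ (M + 1) ≠ 0 := by
      have := hx (M + 1) (by omega) (by push_cast; omega)
      rw [sub_ne_zero]; exact_mod_cast this.symm
    have h1 := (ih x hx0 fun k h0 h => hx k h0 (by push_cast; omega)).mul_right
      (1 - x * q ^ (M + 1))⁻¹
    have h2 := (ih (q ^ (-(M + 1 : ℕ) : ℤ)) (zpow_ne_zero _ hq0) fun k h0 h => by
      rw [← zpow_add₀ hq0]
      exact zpow_ne_one_of_norm_lt_one hq (by push_cast; omega)).mul_right
      (1 - x * q ^ (M + 1))⁻¹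
    -- The new pole `k = M + 1`, with the coefficient given by `qPoch_zpow_neg`.
    have h3 := hasSum_ite_eq ((M : ℤ) + 1)
      (triWeight q (M + 1) * invPoch q (M + 1) / (1 - x * q ^ (M + 1)))
    have h4 := (h1.sub h2).add h3
    have hF := qPoch_zpow_neg hq0 (M + 1)
    have hF0 : qPoch (q ^ (-(M + 1 : ℕ) : ℤ)) q (M + 1) ≠ 0 := by
      intro h
      rw [h, zero_mul] at hF
      exact qPoch_self_ne_zero hq _ hF.symm
    refine h4.of_eq (fun k => ?_) ?_
    · rw [show ((M : ℤ) - k) = (((M + 1 : ℕ) : ℤ) - k) - 1 by push_cast; ring, invPoch_sub_one hq]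
      by_cases hk : k = M + 1
      · subst hk
        simp only [Nat.cast_succ, sub_self, zpow_zero, invPoch_zero, zero_mul, mul_zero, zero_div,
          if_true, mul_one, zero_add]
        norm_cast
      · rw [if_neg hk, add_zero]
        by_cases hk2 : 0 ≤ k ∧ k ≤ M
        · have hu := sub_ne_zero.2 (hx k hk2.1 (by push_cast; omega)).symm
          have hd : 1 - q ^ (((M + 1 : ℕ) : ℤ) - k) ≠ 0 :=
            sub_ne_zero.2 (zpow_ne_one_of_norm_lt_one hq (by push_cast; omega)).symm
          have e1 : q ^ (M + 1) = q ^ (((M + 1 : ℕ) : ℤ) - k) * q ^ k := by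
            rw [← zpow_add₀ hq0, sub_add_cancel, zpow_natCast]
          have e2 : q ^ (-(M + 1 : ℕ) : ℤ) * q ^ k = (q ^ (((M + 1 : ℕ) : ℤ) - k))⁻¹ := by
            rw [← zpow_add₀ hq0, ← zpow_neg]; congr 1; ring
          rw [e1] at hv ⊢
          rw [e2]
          have hA : q ^ (((M + 1 : ℕ) : ℤ) - k) ≠ 0 := zpow_ne_zero _ hq0
          generalize q ^ (((M + 1 : ℕ) : ℤ) - k) = A at *
          have hd2 : A - 1 ≠ 0 := fun h => hd (by linear_combination -h)
          rw [mul_left_comm] at hv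
          simp only [mul_left_comm x A]
          rw [show 1 - A⁻¹ = (A - 1) / A by field_simp]
          generalize x * q ^ k = u at *
          have hv' : 1 - u * A ≠ 0 := by rwa [mul_comm u A]
          field_simp
          ring
        · rcases lt_or_ge k 0 with h | h
          · rw [invPoch_of_neg q h]; simp
          · rw [invPoch_of_neg q (n := ((M + 1 : ℕ) : ℤ) - k) (by push_cast; omega)]; simp
    · rw [← Nat.cast_succ, invPoch_natCast, qPoch_succ, Nat.succ_eq_add_one, ← hF]
      have := triWeight_ne_zero hq0 ((M + 1 : ℕ) : ℤ)
      field_simp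
      ring

/-- The same removal of a pole, now at `x = q ^ (N + 1)`. With `c = q ^ (N + 1)` one has `1 / (1 - c
/ x) = 1 - 1 / (1 - x / c)`, which is why the value at `c` is added here instead of subtracted. -/
theorem hasSum_partialFraction {q : ℂ} (hq0 : q ≠ 0) (hq : ‖q‖ < 1) (M N : ℕ) :
    ∀ x : ℂ, x ≠ 0 → (∀ k : ℤ, -N ≤ k → k ≤ M → x * q ^ k ≠ 1) →
    HasSum (fun k : ℤ => triWeight q k * invPoch q (M - k) * invPoch q (N + k) / (1 - x * q ^ k))
      (1 / (qPoch x q (M + 1) * qPoch (q / x) q N)) := by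
  induction N with
  | zero =>
    intro x hx0 hx
    simpa [qPoch_zero] using hasSum_partialFraction_top hq0 hq M x hx0 (by simpa using hx)
  | succ N ih =>
    intro x hx0 hx
    have hw : 1 - x * q ^ (-(N + 1 : ℕ) : ℤ) ≠ 0 :=
      sub_ne_zero.2 (hx _ (by push_cast; omega) (by push_cast; omega)).symm
    have hqN : q ^ N ≠ 0 := pow_ne_zero _ hq0
    have hv : 1 - q / x * q ^ N ≠ 0 := by
      intro h
      apply hw
      rw [zpow_neg, zpow_natCast, pow_succ]
      field_simp at h ⊢
      linear_combination -h
    have h1 := (ih x hx0 fun k h0 h => hx k (by push_cast; omega) h).mul_right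
      (1 - q / x * q ^ N)⁻¹
    have h2 := (ih (q ^ (N + 1)) (pow_ne_zero _ hq0) fun k h0 h => by
      rw [← zpow_natCast, ← zpow_add₀ hq0]
      exact zpow_ne_one_of_norm_lt_one hq (by push_cast; omega)).mul_right
      (1 - x * q ^ (-(N + 1 : ℕ) : ℤ))⁻¹
    have h3 := hasSum_ite_eq (-(N + 1 : ℕ) : ℤ)
      (triWeight q (-(N + 1 : ℕ) : ℤ) * invPoch q ((N + (M + 1) : ℕ) : ℤ) /
        (1 - x * q ^ (-(N + 1 : ℕ) : ℤ)))
    have h4 := (h1.add h2).add h3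
    have hF := qPoch_zpow_neg hq0 N
    have hF0 : qPoch (q ^ (-N : ℤ)) q N ≠ 0 := by
      intro h
      rw [h, zero_mul] at hF
      exact qPoch_self_ne_zero hq _ hF.symm
    have hG := qPoch_pow_succ_mul q N (M + 1)
    refine h4.of_eq (fun k => ?_) ?_
    · rw [show ((N : ℤ) + k) = (((N + 1 : ℕ) : ℤ) + k) - 1 by push_cast; ring, invPoch_sub_one hq]
      by_cases hk : k = (-(N + 1 : ℕ) : ℤ)
      · subst hk
        rw [add_neg_cancel]
        simp only [invPoch_zero, zpow_zero, sub_self, zero_mul, mul_zero, zero_div,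
          if_true, mul_one, zero_add]
        congr 3
        push_cast
        ring
      · rw [if_neg hk, add_zero]
        by_cases hk2 : -N ≤ k ∧ k ≤ M
        · have hu := sub_ne_zero.2 (hx k (by push_cast; omega) hk2.2).symm
          have hd : 1 - q ^ (((N + 1 : ℕ) : ℤ) + k) ≠ 0 :=
            sub_ne_zero.2 (zpow_ne_one_of_norm_lt_one hq (by push_cast; omega)).symm
          have e1 : q ^ k = q ^ (((N + 1 : ℕ) : ℤ) + k) * q ^ (-(N + 1 : ℕ) : ℤ) := by
            rw [← zpow_add₀ hq0]; congr 1; ring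
          have e2 : q ^ (N + 1) * q ^ k = q ^ (((N + 1 : ℕ) : ℤ) + k) := by
            rw [← zpow_natCast, ← zpow_add₀ hq0]
          have e3 : q / x * q ^ N = (x * q ^ (-(N + 1 : ℕ) : ℤ))⁻¹ := by
            rw [zpow_neg, zpow_natCast, pow_succ]
            field_simp
          rw [e2]
          rw [e3] at hv ⊢
          rw [e1] at hu ⊢
          have hw0 : q ^ (-(N + 1 : ℕ) : ℤ) ≠ 0 := zpow_ne_zero _ hq0
          generalize q ^ (((N + 1 : ℕ) : ℤ) + k) = A at *
          generalize q ^ (-(N + 1 : ℕ) : ℤ) = w at *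
          have hw2 : x * w - 1 ≠ 0 := fun h => hw (by linear_combination -h)
          have hu' : 1 - A * (x * w) ≠ 0 := by rwa [mul_left_comm] at hu
          rw [show x * (A * w) = A * (x * w) by ring]
          have hy : x * w ≠ 0 := mul_ne_zero hx0 hw0
          generalize x * w = y at *
          rw [show 1 - y⁻¹ = (y - 1) / y by field_simp]
          field_simp
          ring
        · rcases lt_or_ge (k : ℤ) (-(N + 1 : ℕ)) with h | h
          · rw [invPoch_of_neg q (n := ((N + 1 : ℕ) : ℤ) + k) (by omega)]; simp
          · rw [invPoch_of_neg q (n := ((M : ℕ) : ℤ) - k) (by push_cast at *; omega)]; simp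
    · rw [invPoch_natCast, ← hG, qPoch_succ (q / x),
        show (-(N + 1 : ℕ) : ℤ) = -1 - N by push_cast; ring, triWeight_reflect,
        show q / q ^ (N + 1) = q ^ (-N : ℤ) by
          rw [zpow_neg, zpow_natCast, pow_succ]; field_simp, ← hF]
      have := triWeight_ne_zero hq0 (N : ℤ)
      field_simp
      ring

/-! ### The theta function, the Appell sum, and the expansion of the reciprocal theta function. -/

/-- The theta function `(x; q)_∞ (q / x; q)_∞ (q; q)_∞`. -/
noncomputable def theta (x q : ℂ) : ℂ := qPochInf x q * qPochInf (q / x) q * qPochInf q q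

/-- The signed weight `(-1) ^ k q ^ (3 k (k + 1) / 2)`. -/
noncomputable def cubicWeight (q : ℂ) (k : ℤ) : ℂ := (-1) ^ k * q ^ (3 * tri k)

/-- The level three Appell sum `∑_k (-1) ^ k q ^ (3 k (k + 1) / 2) / (1 - x q ^ k)`. -/
noncomputable def appellSum (x q : ℂ) : ℂ := ∑' k : ℤ, cubicWeight q k / (1 - x * q ^ k)

theorem cubicWeight_eq (q : ℂ) (k : ℤ) : cubicWeight q k = triWeight q k * q ^ (2 * tri k) := by
  rcases eq_or_ne q 0 with rfl | hq0
  · rcases (tri_nonneg k).eq_or_lt with h | h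
    · simp [cubicWeight, triWeight, ← h]
    · rw [cubicWeight, triWeight, zero_zpow _ (by omega), zero_zpow _ h.ne']; simp
  · rw [cubicWeight, triWeight, mul_assoc, ← zpow_add₀ hq0]
    ring_nf

theorem cubicWeight_reflect (q : ℂ) (k : ℤ) : cubicWeight q (-1 - k) = - cubicWeight q k := by
  rw [cubicWeight_eq, cubicWeight_eq, triWeight_reflect, tri_reflect, neg_mul]

theorem norm_cubicWeight (q : ℂ) (k : ℤ) : ‖cubicWeight q k‖ = (‖q‖ ^ 3) ^ tri k := by
  rw [cubicWeight, norm_mul, norm_neg_one_zpow, one_mul, norm_zpow, zpow_mul]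
  norm_cast

theorem summable_norm_cubicWeight {q : ℂ} (hq0 : q ≠ 0) (hq : ‖q‖ < 1) :
    Summable fun k : ℤ => ‖cubicWeight q k‖ := by
  have := summable_zpow_tri (ρ := ‖q‖ ^ 3) (by positivity)
    (pow_lt_one₀ (norm_nonneg q) hq (by norm_num)) one_pos
  simpa [norm_cubicWeight] using this

theorem summable_mul_of_norm_le {ι : Type*} {f g : ι → ℂ} {B : ℝ} (hf : Summable fun i => ‖f i‖)
    (hg : ∀ i, ‖g i‖ ≤ B) : Summable fun i => f i * g i :=
  Summable.of_norm_bounded (hf.mul_right B) fun i => by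
    rw [norm_mul]
    exact mul_le_mul_of_nonneg_left (hg i) (norm_nonneg _)

theorem summable_appellSum {x q : ℂ} (hx0 : x ≠ 0) (hq0 : q ≠ 0) (hq : ‖q‖ < 1) :
    Summable fun k : ℤ => cubicWeight q k / (1 - x * q ^ k) := by
  obtain ⟨B, -, hB⟩ := exists_norm_inv_one_sub_le hx0 hq0 hq
  exact summable_mul_of_norm_le (summable_norm_cubicWeight hq0 hq) hB

theorem mul_pow_ne_one {x q : ℂ} (hx : ∀ k : ℤ, x * q ^ k ≠ 1) (k : ℕ) : x * q ^ k ≠ 1 := by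
  simpa using hx k

theorem div_mul_pow_ne_one {x q : ℂ} (hx0 : x ≠ 0) (hq0 : q ≠ 0) (hx : ∀ k : ℤ, x * q ^ k ≠ 1)
    (k : ℕ) : q / x * q ^ k ≠ 1 := by
  intro h
  apply hx (-(k + 1 : ℕ))
  rw [zpow_neg, zpow_natCast, pow_succ]
  field_simp at h ⊢
  exact h.symm

theorem qPoch_ne_zero {x q : ℂ} (hx : ∀ k : ℕ, x * q ^ k ≠ 1) (n : ℕ) : qPoch x q n ≠ 0 :=
  Finset.prod_ne_zero_iff.2 fun k _ => sub_ne_zero.2 (hx k).symm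

theorem theta_ne_zero {x q : ℂ} (hx0 : x ≠ 0) (hq0 : q ≠ 0) (hq : ‖q‖ < 1)
    (hx : ∀ k : ℤ, x * q ^ k ≠ 1) : theta x q ≠ 0 :=
  mul_ne_zero (mul_ne_zero (qPochInf_ne_zero hq (mul_pow_ne_one hx))
    (qPochInf_ne_zero hq (div_mul_pow_ne_one hx0 hq0 hx))) (qPochInf_self_ne_zero hq)

theorem tendsto_invPoch_sub {q : ℂ} (hq : ‖q‖ < 1) (k : ℤ) :
    Tendsto (fun n : ℕ => invPoch q (n - k)) atTop (𝓝 (qPochInf q q)⁻¹) :=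
  (tendsto_invPoch_atTop hq).comp
    (tendsto_atTop_add_const_right _ (-k) tendsto_natCast_atTop_atTop)

theorem tendsto_invPoch_add {q : ℂ} (hq : ‖q‖ < 1) (k : ℤ) :
    Tendsto (fun n : ℕ => invPoch q (n + k)) atTop (𝓝 (qPochInf q q)⁻¹) :=
  (tendsto_invPoch_atTop hq).comp
    (tendsto_atTop_add_const_right _ k tendsto_natCast_atTop_atTop)

/-- Partial fraction expansion of the reciprocal of the theta function. -/
theorem hasSum_theta_inv {x q : ℂ} (hx0 : x ≠ 0) (hq0 : q ≠ 0) (hq : ‖q‖ < 1)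
    (hx : ∀ k : ℤ, x * q ^ k ≠ 1) :
    HasSum (fun k : ℤ => triWeight q k / (1 - x * q ^ k)) (qPochInf q q ^ 3 / theta x q) := by
  have hE := qPochInf_self_ne_zero hq
  obtain ⟨C, hC0, hC⟩ := exists_norm_inv_one_sub_le hx0 hq0 hq
  obtain ⟨B, hB0, hB⟩ := exists_norm_invPoch_le hq
  have hsum := summable_mul_of_norm_le (summable_norm_triWeight hq0 hq) hC
  -- Let `M = N = n → ∞` in the finite partial fractions; the bounds on `invPoch` and on the inverse
  -- denominators give domination by `‖triWeight q k‖`.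
  have key := tendsto_tsum_of_dominated_convergence (𝓕 := atTop)
    (f := fun (n : ℕ) (k : ℤ) =>
      triWeight q k * invPoch q (n - k) * invPoch q (n + k) / (1 - x * q ^ k))
    (g := fun k => triWeight q k * (qPochInf q q)⁻¹ * (qPochInf q q)⁻¹ / (1 - x * q ^ k))
    (bound := fun k => ‖triWeight q k‖ * (B * B * C))
    ((summable_norm_triWeight hq0 hq).mul_right _)
    (fun k => (((tendsto_invPoch_sub hq k).const_mul _).mul (tendsto_invPoch_add hq k)).div_const _)
    (.of_forall fun n k => by
      rw [div_eq_mul_inv, norm_mul, norm_mul, norm_mul, mul_assoc, mul_assoc, ← mul_assoc ‖_‖ ‖_‖ ‖_‖]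
      refine mul_le_mul_of_nonneg_left ?_ (norm_nonneg _)
      gcongr
      · exact hB _
      · exact hB _
      · exact hC _)
  have h2 : Tendsto (fun n : ℕ => 1 / (qPoch x q (n + 1) * qPoch (q / x) q n)) atTop
      (𝓝 (1 / (qPochInf x q * qPochInf (q / x) q))) := by
    refine tendsto_const_nhds.div
      (((tendsto_qPoch hq x).comp (tendsto_add_atTop_nat 1)).mul (tendsto_qPoch hq _)) ?_
    exact mul_ne_zero (qPochInf_ne_zero hq (mul_pow_ne_one hx))
      (qPochInf_ne_zero hq (div_mul_pow_ne_one hx0 hq0 hx))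
  have h3 := tendsto_nhds_unique (key.congr fun n =>
    (hasSum_partialFraction hq0 hq n n x hx0 fun k _ _ => hx k).tsum_eq) h2
  have hs : HasSum (fun k : ℤ => triWeight q k / (1 - x * q ^ k))
    (∑' k : ℤ, triWeight q k / (1 - x * q ^ k)) := hsum.hasSum
  convert hs
  have h4 : ∑' k : ℤ, triWeight q k * (qPochInf q q)⁻¹ * (qPochInf q q)⁻¹ / (1 - x * q ^ k)
      = (∑' k : ℤ, triWeight q k / (1 - x * q ^ k)) * ((qPochInf q q)⁻¹ * (qPochInf q q)⁻¹) := by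
    rw [← tsum_mul_right]
    exact tsum_congr fun k => by ring
  rw [h4] at h3
  rw [theta]
  have hA := qPochInf_ne_zero hq (mul_pow_ne_one hx)
  have hB := qPochInf_ne_zero hq (div_mul_pow_ne_one hx0 hq0 hx)
  generalize ∑' k : ℤ, triWeight q k / (1 - x * q ^ k) = S at *
  field_simp at h3 ⊢
  linear_combination -h3

/-! ### Cauchy's identity and the Appell form of the mock theta function. -/

theorem summable_cauchy {q : ℂ} (hq : ‖q‖ < 1) (a : ℕ) :
    Summable fun m : ℕ => q ^ (m ^ 2 + a * m) * invPoch q m * invPoch q (m + a) := by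
  obtain ⟨B, hB0, hB⟩ := exists_norm_invPoch_le hq
  refine Summable.of_norm_bounded
    ((summable_geometric_of_lt_one (norm_nonneg q) hq).mul_right (B * B)) fun m => ?_
  rw [mul_assoc, norm_mul, norm_mul, norm_pow]
  have : ‖q‖ ^ (m ^ 2 + a * m) ≤ ‖q‖ ^ m :=
    pow_le_pow_of_le_one (norm_nonneg q) hq.le (by nlinarith [Nat.le_self_pow two_ne_zero m])
  gcongr
  · exact hB _
  · exact hB _

/-- Termwise, `invPoch_sub_one` produces a factor `invPoch q (m - 1)`. Its term at `m = 0` vanishes,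
and shifting `m` gives the sum with parameter `a + 2`. -/
theorem cauchy_recurrence {q : ℂ} (hq : ‖q‖ < 1) (a : ℕ) :
    (∑' m : ℕ, q ^ (m ^ 2 + a * m) * invPoch q m * invPoch q (m + a))
      - ∑' m : ℕ, q ^ (m ^ 2 + (a + 1) * m) * invPoch q m * invPoch q (m + (a + 1 : ℕ))
    = q ^ (a + 1) *
      ((∑' m : ℕ, q ^ (m ^ 2 + (a + 2) * m) * invPoch q m * invPoch q (m + (a + 2 : ℕ)))
      - ∑' m : ℕ, q ^ (m ^ 2 + (a + 1) * m) * invPoch q m * invPoch q (m + (a + 1 : ℕ))) := by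
  have h0 := summable_cauchy hq a
  have h1 := summable_cauchy hq (a + 1)
  have h2 := summable_cauchy hq (a + 2)
  have e : ∀ m : ℕ, q ^ (m ^ 2 + a * m) * invPoch q m * invPoch q (m + a)
      - q ^ (m ^ 2 + (a + 1) * m) * invPoch q m * invPoch q (m + (a + 1 : ℕ))
      + q ^ (a + 1) * (q ^ (m ^ 2 + (a + 1) * m) * invPoch q m * invPoch q (m + (a + 1 : ℕ)))
      = q ^ (m ^ 2 + a * m) * invPoch q (m - 1) * invPoch q (m + (a + 1 : ℕ)) := by
    intro m
    have := invPoch_sub_one hq (m + (a + 1 : ℕ))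
    rw [show (m : ℤ) + (a + 1 : ℕ) - 1 = m + a by push_cast; ring] at this
    rw [this, invPoch_sub_one hq, ← Nat.cast_add, zpow_natCast, zpow_natCast]
    ring
  have hs : Summable fun m : ℕ =>
      q ^ (m ^ 2 + a * m) * invPoch q (m - 1) * invPoch q (m + (a + 1 : ℕ)) :=
    ((h0.sub h1).add (h1.mul_left (q ^ (a + 1)))).congr e
  have h3 := hs.tsum_eq_zero_add
  rw [← tsum_congr e, (h0.sub h1).tsum_add (h1.mul_left _), h0.tsum_sub h1, tsum_mul_left,
    Nat.cast_zero, invPoch_of_neg q (n := 0 - 1) (by norm_num), mul_zero, zero_mul, zero_add] at h3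
  have h4 : ∑' m : ℕ, q ^ ((m + 1) ^ 2 + a * (m + 1)) * invPoch q ((m + 1 : ℕ) - 1)
      * invPoch q ((m + 1 : ℕ) + (a + 1 : ℕ))
      = q ^ (a + 1) *
        ∑' m : ℕ, q ^ (m ^ 2 + (a + 2) * m) * invPoch q m * invPoch q (m + (a + 2 : ℕ)) := by
    rw [← tsum_mul_left]
    refine tsum_congr fun m => ?_
    rw [show ((m + 1 : ℕ) : ℤ) - 1 = m by push_cast; ring,
      show ((m + 1 : ℕ) : ℤ) + (a + 1 : ℕ) = m + (a + 2 : ℕ) by push_cast; ring]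
    ring
  rw [h4] at h3
  linear_combination h3

/-- Iterating the inequality forward `n` times bounds `‖d a‖` by `r ^ n * D`. -/
theorem eq_zero_of_norm_le_mul {d : ℕ → ℂ} {r D : ℝ} (hr0 : 0 ≤ r) (hr : r < 1)
    (hD : ∀ a, ‖d a‖ ≤ D) (hd : ∀ a, ‖d a‖ ≤ r * ‖d (a + 1)‖) (a : ℕ) : d a = 0 := by
  have h : ∀ n a, ‖d a‖ ≤ r ^ n * D := by
    intro n
    induction n with
    | zero => simpa using hD
    | succ n ih =>
      intro a
      refine (hd a).trans ?_
      rw [pow_succ', mul_assoc]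
      exact mul_le_mul_of_nonneg_left (ih _) hr0
  have hl : Tendsto (fun n : ℕ => r ^ n * D) atTop (𝓝 (0 * D)) :=
    (tendsto_pow_atTop_nhds_zero_of_lt_one hr0 hr).mul_const D
  rw [zero_mul] at hl
  exact norm_le_zero_iff.1 (ge_of_tendsto' hl fun n => h n a)

/-- By the recurrence, the consecutive differences of the sums are bounded and contract towards
smaller `a`, hence vanish. The sum is thus independent of `a`, and as `a → ∞` only its term `m = 0`
remains. -/
theorem tsum_cauchy {q : ℂ} (hq0 : q ≠ 0) (hq : ‖q‖ < 1) (a : ℕ) :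
    ∑' m : ℕ, q ^ (m ^ 2 + a * m) * invPoch q m * invPoch q (m + a) = (qPochInf q q)⁻¹ := by
  set S : ℕ → ℂ := fun a => ∑' m : ℕ, q ^ (m ^ 2 + a * m) * invPoch q m * invPoch q (m + a) with hS
  obtain ⟨B, hB0, hB⟩ := exists_norm_invPoch_le hq
  have hgeo := (summable_geometric_of_lt_one (norm_nonneg q) hq).mul_right (B * B)
  have hbd : ∀ a m : ℕ, ‖q ^ (m ^ 2 + a * m) * invPoch q m * invPoch q (m + a)‖
      ≤ ‖q‖ ^ m * (B * B) := by
    intro a m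
    rw [mul_assoc, norm_mul, norm_mul, norm_pow]
    have : ‖q‖ ^ (m ^ 2 + a * m) ≤ ‖q‖ ^ m :=
      pow_le_pow_of_le_one (norm_nonneg q) hq.le (by nlinarith [Nat.le_self_pow two_ne_zero m])
    gcongr
    · exact hB _
    · exact hB _
  have hSle : ∀ a, ‖S a‖ ≤ ∑' m, ‖q‖ ^ m * (B * B) := fun a =>
    tsum_of_norm_bounded hgeo.hasSum (hbd a)
  have hd : ∀ a, S a - S (a + 1) = 0 := by
    refine eq_zero_of_norm_le_mul (norm_nonneg q) hq
      (D := (∑' m, ‖q‖ ^ m * (B * B)) + ∑' m, ‖q‖ ^ m * (B * B))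
      (fun a => (norm_sub_le _ _).trans (add_le_add (hSle _) (hSle _))) fun a => ?_
    have h := cauchy_recurrence hq a
    change S a - S (a + 1) = q ^ (a + 1) * (S (a + 2) - S (a + 1)) at h
    rw [h, norm_mul, norm_pow, norm_sub_rev]
    refine mul_le_mul_of_nonneg_right ?_ (norm_nonneg _)
    exact pow_le_of_le_one (norm_nonneg q) hq.le a.succ_ne_zero
  have hconst : ∀ n, S (a + n) = S a := by
    intro n
    induction n with
    | zero => rfl
    | succ n ih => rw [← ih, ← add_assoc]; exact (sub_eq_zero.1 (hd _)).symm
  have hlim : Tendsto S atTop (𝓝 (∑' m : ℕ, if m = 0 then (qPochInf q q)⁻¹ else 0)) := by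
    refine tendsto_tsum_of_dominated_convergence hgeo (fun m => ?_) (.of_forall hbd)
    rcases m with _ | m
    · simpa [invPoch_zero] using tendsto_invPoch_add hq 0
    · have h1 : Tendsto (fun a : ℕ => q ^ ((m + 1) ^ 2 + a * (m + 1))) atTop (𝓝 0) := by
        have := (tendsto_pow_atTop_nhds_zero_of_norm_lt_one (x := q ^ (m + 1)) (by
          rw [norm_pow]; exact pow_lt_one₀ (norm_nonneg q) hq m.succ_ne_zero)).const_mul
            (q ^ ((m + 1) ^ 2))
        rw [mul_zero] at this
        exact this.congr fun a => by rw [← pow_mul, ← pow_add]; ring_nf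
      have h2 := (h1.mul_const (invPoch q (m + 1 : ℕ))).mul (tendsto_invPoch_add hq (m + 1 : ℕ))
      simp only [zero_mul] at h2
      simp only [Nat.add_eq_zero_iff, one_ne_zero, and_false, if_false]
      exact h2.congr fun a => by rw [add_comm (a : ℤ)]
  rw [tsum_ite_eq] at hlim
  refine tendsto_nhds_unique ?_ (hlim.comp (tendsto_add_atTop_nat a))
  exact tendsto_const_nhds.congr fun n => by
    rw [Function.comp_apply, add_comm n a, hconst]

/-- Terms with `n < k` vanish; putting `n = m + k`, the exponent becomes `k (k + 1) + m ^ 2 + (2 k +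
1) m`, which is Cauchy's identity with `a = 2 k + 1`. -/
theorem hasSum_cauchy_nat {q : ℂ} (hq0 : q ≠ 0) (hq : ‖q‖ < 1) (k : ℕ) :
    HasSum (fun n : ℕ => q ^ (n ^ 2 + n) * invPoch q (n - k) * invPoch q (n + 1 + k))
      (q ^ (2 * tri k) * (qPochInf q q)⁻¹) := by
  have hinj : Function.Injective fun m : ℕ => m + k := add_left_injective k
  rw [← hinj.hasSum_iff]
  · have h := ((summable_cauchy hq (2 * k + 1)).hasSum).mul_left (q ^ (2 * tri k))
    rw [tsum_cauchy hq0 hq] at h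
    refine h.of_eq (fun m => ?_) rfl
    simp only [Function.comp_apply]
    rw [two_mul_tri, ← zpow_natCast, ← zpow_natCast, show ((m + k : ℕ) : ℤ) - k = m by push_cast; ring,
      show ((m + k : ℕ) : ℤ) + 1 + k = m + (2 * k + 1 : ℕ) by push_cast; ring,
      show (((m + k) ^ 2 + (m + k) : ℕ) : ℤ) = (k : ℤ) * (k + 1) + (m ^ 2 + (2 * k + 1) * m : ℕ) by
        push_cast; ring, zpow_add₀ hq0]
    ring
  · intro n hn
    have : (n : ℤ) - k < 0 := by
      by_contra h
      exact hn ⟨n - k, by simp only; omega⟩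
    rw [invPoch_of_neg q this]
    simp

theorem hasSum_cauchy {q : ℂ} (hq0 : q ≠ 0) (hq : ‖q‖ < 1) (k : ℤ) :
    HasSum (fun n : ℕ => q ^ (n ^ 2 + n) * invPoch q (n - k) * invPoch q (n + 1 + k))
      (q ^ (2 * tri k) * (qPochInf q q)⁻¹) := by
  rcases le_or_gt 0 k with h | h
  · lift k to ℕ using h
    exact hasSum_cauchy_nat hq0 hq k
  · obtain ⟨j, rfl⟩ : ∃ j : ℕ, k = -1 - j := ⟨(-1 - k).toNat, by omega⟩
    refine (hasSum_cauchy_nat hq0 hq j).of_eq (fun n => ?_) (by rw [tri_reflect])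
    rw [show (n : ℤ) - (-1 - j) = n + 1 + j by ring, show (n : ℤ) + 1 + (-1 - j) = n - j by ring]
    ring

/-- The universal mock theta function as an Appell sum. -/
theorem hasSum_appellSum {x q : ℂ} (hx0 : x ≠ 0) (hq0 : q ≠ 0) (hq : ‖q‖ < 1)
    (hx : ∀ k : ℤ, x * q ^ k ≠ 1) :
    HasSum (fun n : ℕ => q ^ (n ^ 2 + n) / (qPoch x q (n + 1) * qPoch (q / x) q (n + 1)))
      (appellSum x q / qPochInf q q) := by
  obtain ⟨C, hC0, hC⟩ := exists_norm_inv_one_sub_le hx0 hq0 hq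
  obtain ⟨B, hB0, hB⟩ := exists_norm_invPoch_le hq
  set F : ℕ × ℤ → ℂ := fun p => q ^ (p.1 ^ 2 + p.1) *
    (triWeight q p.2 * invPoch q (p.1 - p.2) * invPoch q ((p.1 + 1 : ℕ) + p.2)
      / (1 - x * q ^ p.2)) with hF
  have hsum : Summable F := by
    have h := ((summable_geometric_of_lt_one (norm_nonneg q) hq).mul_of_nonneg
      (summable_norm_triWeight hq0 hq) (fun _ => by positivity) (fun _ => by positivity)).mul_right
        (B * B * C)
    refine Summable.of_norm_bounded h fun p => ?_
    rw [hF]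
    simp only
    rw [div_eq_mul_inv, norm_mul, norm_mul, norm_mul, norm_mul, norm_pow, mul_assoc ‖triWeight _ _‖,
      mul_assoc ‖triWeight _ _‖, ← mul_assoc]
    have : ‖q‖ ^ (p.1 ^ 2 + p.1) ≤ ‖q‖ ^ p.1 :=
      pow_le_pow_of_le_one (norm_nonneg q) hq.le (by nlinarith)
    gcongr
    · exact hB _
    · exact hB _
    · exact hC _
  -- Unequal lengths `n` and `n + 1` are what make both Pochhammer symbols have length `n + 1`.
  have hrow : ∀ n : ℕ, HasSum (fun k => F (n, k))
      (q ^ (n ^ 2 + n) / (qPoch x q (n + 1) * qPoch (q / x) q (n + 1))) := fun n =>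
    ((hasSum_partialFraction hq0 hq n (n + 1) x hx0 fun k _ _ => hx k).mul_left
      (q ^ (n ^ 2 + n))).of_eq
      (fun k => rfl) (by ring)
  -- Summing over `n` first, Cauchy's identity supplies `q ^ (2 * tri k)`, which raises `triWeight`
  -- to `cubicWeight`.
  have hcol : ∀ k : ℤ, HasSum (fun n => F (n, k))
      (cubicWeight q k / (1 - x * q ^ k) * (qPochInf q q)⁻¹) := fun k =>
    ((hasSum_cauchy hq0 hq k).mul_right (triWeight q k / (1 - x * q ^ k))).of_eq
      (fun n => by simp only [hF]; push_cast; ring) (by rw [cubicWeight_eq]; ring)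
  have h1 := hsum.hasSum.prod_fiberwise hrow
  have h2 := (Equiv.prodComm ℤ ℕ).hasSum_iff.2 hsum.hasSum |>.prod_fiberwise hcol
  have h3 : HasSum (fun k => cubicWeight q k / (1 - x * q ^ k) * (qPochInf q q)⁻¹)
      (appellSum x q * (qPochInf q q)⁻¹) := (summable_appellSum hx0 hq0 hq).hasSum.mul_right _
  rwa [h2.unique h3] at h1

/-- Each term of the mock theta series is `x` times the corresponding term of `hasSum_appellSum`
plus a difference `u n - u (n + 1)`. The differences telescope to `u 0 = 1`, which cancels the `-1`
in the definition. -/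
theorem mockG_eq_appellSum {x q : ℂ} (hx0 : x ≠ 0) (hq0 : q ≠ 0) (hq : ‖q‖ < 1)
    (hx : ∀ k : ℤ, x * q ^ k ≠ 1) : mockG x q = appellSum x q / qPochInf q q := by
  have hP := qPoch_ne_zero (mul_pow_ne_one hx)
  have hQ := qPoch_ne_zero (div_mul_pow_ne_one hx0 hq0 hx)
  set u : ℕ → ℂ := fun n => q ^ (n ^ 2) / (qPoch x q n * qPoch (q / x) q n) with hu
  have hus : Summable u := by
    obtain ⟨B, hB0, hB⟩ := exists_norm_le_of_tendsto
      (((tendsto_qPoch hq x).mul (tendsto_qPoch hq (q / x))).inv₀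
        (mul_ne_zero (qPochInf_ne_zero hq (mul_pow_ne_one hx))
          (qPochInf_ne_zero hq (div_mul_pow_ne_one hx0 hq0 hx))))
    refine Summable.of_norm_bounded
      ((summable_geometric_of_lt_one (norm_nonneg q) hq).mul_right B) fun n => ?_
    rw [hu]
    simp only
    rw [div_eq_mul_inv, norm_mul, norm_pow]
    have : ‖q‖ ^ (n ^ 2) ≤ ‖q‖ ^ n :=
      pow_le_pow_of_le_one (norm_nonneg q) hq.le (Nat.le_self_pow two_ne_zero n)
    gcongr
    exact hB _
  have h1 := (((hasSum_appellSum hx0 hq0 hq hx).mul_left x).add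
    (hus.hasSum.sub ((summable_nat_add_iff 1).2 hus).hasSum))
  have h2 : ∀ n : ℕ, q ^ (n ^ 2) / (qPoch x q (n + 1) * qPoch (q / x) q n)
      = x * (q ^ (n ^ 2 + n) / (qPoch x q (n + 1) * qPoch (q / x) q (n + 1)))
        + (u n - u (n + 1)) := by
    intro n
    have hA := hP n
    have hB := hQ n
    have hA1 := hP (n + 1)
    have hB1 := hQ (n + 1)
    rw [qPoch_succ] at hA1 hB1
    have hA2 := right_ne_zero_of_mul hA1
    have hB2 := right_ne_zero_of_mul hB1
    have e : q / x * q ^ n * (x * q ^ n) = q ^ (n + n + 1) := by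
      field_simp
      ring
    simp only [hu, qPoch_succ, show (n + 1) ^ 2 = n ^ 2 + (n + n + 1) by ring, pow_add q (n ^ 2)]
    rw [← e]
    generalize q / x * q ^ n = c at *
    field_simp
    ring
  have h3 : u 0 = 1 := by simp [hu, qPoch_zero]
  rw [mockG, tsum_congr h2, h1.tsum_eq, hus.tsum_eq_zero_add, h3]
  field_simp
  ring

/-! ### The Jacobi triple product. -/

/-- A form of the finite `q`-binomial theorem: each new linear factor acts on the series as the
identity minus a multiple of an index shift. -/
theorem hasSum_finite_tripleProduct {x q : ℂ} (hx0 : x ≠ 0) (hq0 : q ≠ 0) (hq : ‖q‖ < 1)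
    (M N : ℕ) :
    HasSum (fun k : ℤ => triWeight q k * x ^ (-k) * invPoch q (M + k) * invPoch q (N - k)
        * qPoch q q (M + N))
      (qPoch x q M * qPoch (q / x) q N) := by
  induction M with
  | zero =>
    induction N with
    | zero =>
      refine (hasSum_single (0 : ℤ) fun k hk => ?_).of_eq (fun _ => rfl) ?_
      · rcases lt_or_gt_of_ne hk with h | h
        · rw [invPoch_of_neg q (n := ((0 : ℕ) : ℤ) + k) (by push_cast; omega)]; simp
        · rw [invPoch_of_neg q (n := ((0 : ℕ) : ℤ) - k) (by push_cast; omega)]; simp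
      · simp [qPoch_zero, triWeight, tri_zero, invPoch_zero]
    | succ N ih =>
      have h := ih.sub (((Equiv.subRight (1 : ℤ)).hasSum_iff.2 ih).mul_left (q / x * q ^ N))
      refine h.of_eq (fun k => ?_) (by rw [qPoch_succ]; ring)
      simp only [Function.comp_apply, Equiv.subRight_apply, ← add_assoc]
      have e1 := invPoch_sub_one hq (((N + 1 : ℕ) : ℤ) - k)
      have e2 := invPoch_sub_one hq (((0 : ℕ) : ℤ) + k)
      have e3 := triWeight_add_one hq0 (k - 1)
      rw [sub_add_cancel] at e3
      rw [show ((N + 1 : ℕ) : ℤ) - k - 1 = N - k by push_cast; ring] at e1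
      rw [show ((N : ℕ) : ℤ) - (k - 1) = (N + 1 : ℕ) - k by push_cast; ring, ← add_sub_assoc,
        e1, e2, e3, qPoch_succ, neg_sub, sub_eq_add_neg (1 : ℤ) k, zpow_add₀ hx0, zpow_one]
      rw [show q ^ (((N + 1 : ℕ) : ℤ) - k) = q ^ N * q * (q ^ k)⁻¹ by
        rw [zpow_sub₀ hq0, zpow_natCast, pow_succ]; rfl]
      have hk : q ^ k ≠ 0 := zpow_ne_zero _ hq0
      simp only [Nat.cast_zero, zero_add]
      field_simp
      ring
  | succ M ih =>
    have h := ih.sub (((Equiv.addRight (1 : ℤ)).hasSum_iff.2 ih).mul_left (x * q ^ M))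
    refine h.of_eq (fun k => ?_) (by rw [qPoch_succ]; ring)
    simp only [Function.comp_apply, Equiv.coe_addRight]
    have e1 := invPoch_sub_one hq ((N : ℤ) - k)
    have e2 := invPoch_sub_one hq (((M + 1 : ℕ) : ℤ) + k)
    rw [show ((M + 1 : ℕ) : ℤ) + k - 1 = M + k by push_cast; ring] at e2
    rw [show ((M : ℕ) : ℤ) + (k + 1) = (M + 1 : ℕ) + k by push_cast; ring,
      show (N : ℤ) - (k + 1) = N - k - 1 by ring, e1, e2, triWeight_add_one hq0,
      show M + 1 + N = M + N + 1 by ring, qPoch_succ, neg_add, zpow_add₀ hx0, zpow_neg_one]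
    rw [show q ^ (((M + 1 : ℕ) : ℤ) + k) = q ^ M * q * q ^ k by
        rw [zpow_add₀ hq0, zpow_natCast, pow_succ],
      show q ^ ((N : ℤ) - k) = q ^ N * (q ^ k)⁻¹ by
        rw [zpow_sub₀ hq0, zpow_natCast]; rfl, zpow_add₀ hq0, zpow_one]
    have hk : q ^ k ≠ 0 := zpow_ne_zero _ hq0
    field_simp
    ring

/-- **Jacobi triple product identity.** -/
theorem hasSum_theta {x q : ℂ} (hx0 : x ≠ 0) (hq0 : q ≠ 0) (hq : ‖q‖ < 1) :
    HasSum (fun k : ℤ => triWeight q k * x ^ (-k)) (theta x q) := by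
  have hE := qPochInf_self_ne_zero hq
  obtain ⟨B, hB0, hB⟩ := exists_norm_invPoch_le hq
  obtain ⟨C, hC0, hC⟩ := exists_norm_le_of_tendsto (tendsto_qPoch hq q)
  have hs : Summable fun k : ℤ => ‖triWeight q k * x ^ (-k)‖ := by
    refine (summable_zpow_tri (norm_pos_iff.2 hq0) hq (r := ‖x‖⁻¹)
      (inv_pos.2 (norm_pos_iff.2 hx0))).congr fun k => ?_
    rw [norm_mul, norm_triWeight, norm_zpow, zpow_neg, inv_zpow]
  have h2 : Tendsto (fun n : ℕ => n + n) atTop atTop :=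
    tendsto_atTop_mono (fun n => Nat.le_add_left n n) tendsto_id
  have key := tendsto_tsum_of_dominated_convergence (𝓕 := atTop)
    (f := fun (n : ℕ) (k : ℤ) =>
      triWeight q k * x ^ (-k) * invPoch q (n + k) * invPoch q (n - k) * qPoch q q (n + n))
    (g := fun k => triWeight q k * x ^ (-k) * (qPochInf q q)⁻¹ * (qPochInf q q)⁻¹ * qPochInf q q)
    (bound := fun k => ‖triWeight q k * x ^ (-k)‖ * (B * B * C))
    (hs.mul_right _)
    (fun k => ((((tendsto_invPoch_add hq k).const_mul _).mul (tendsto_invPoch_sub hq k)).mul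
      ((tendsto_qPoch hq q).comp h2)))
    (.of_forall fun n k => by
      rw [mul_assoc, mul_assoc, norm_mul, ← mul_assoc (invPoch _ _), norm_mul (_ * _),
        norm_mul (invPoch _ _)]
      gcongr
      · exact hB _
      · exact hB _
      · exact hC _)
  have h3 := tendsto_nhds_unique
    (key.congr fun n => (hasSum_finite_tripleProduct hx0 hq0 hq n n).tsum_eq)
    ((tendsto_qPoch hq x).mul (tendsto_qPoch hq (q / x)))
  have h4 := hs.of_norm.hasSum
  refine h4.of_eq (fun _ => rfl) ?_
  rw [theta, ← h3, ← tsum_mul_right]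
  exact tsum_congr fun k => by field_simp

/-! ### Functional equations and special values of the theta function. -/

theorem theta_div {x q : ℂ} (hq0 : q ≠ 0) : theta (q / x) q = theta x q := by
  rw [theta, theta, div_div_cancel₀ hq0]
  ring

theorem theta_mul {x q : ℂ} (hx0 : x ≠ 0) (hq0 : q ≠ 0) (hq : ‖q‖ < 1) :
    theta (x * q) q = -x⁻¹ * theta x q := by
  rw [theta, theta, qPochInf_step hq x, show q / (x * q) = x⁻¹ by field_simp,
    qPochInf_step hq x⁻¹, show x⁻¹ * q = q / x by ring]
  field_simp
  ring

theorem triWeight_mul_theta {x q : ℂ} (hx0 : x ≠ 0) (hq0 : q ≠ 0) (hq : ‖q‖ < 1) (n : ℤ) :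
    triWeight q n * theta (x * q ^ (-n)) q = x ^ n * theta x q := by
  have step : ∀ n : ℤ, triWeight q (n + 1) * theta (x * q ^ (-(n + 1))) q
      = x * (triWeight q n * theta (x * q ^ (-n)) q) := by
    intro n
    have h := theta_mul (mul_ne_zero hx0 (zpow_ne_zero (-(n + 1)) hq0)) hq0 hq
    rw [mul_assoc, ← zpow_add_one₀ hq0, show -(n + 1) + 1 = -n by ring] at h
    have hn : q ^ (n + 1) ≠ 0 := zpow_ne_zero _ hq0
    rw [h, triWeight_add_one hq0, zpow_neg]
    field_simp
  induction n using Int.induction_on with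
  | zero => simp [triWeight, tri_zero]
  | succ n ih => rw [step, ih, zpow_add_one₀ hx0]; ring
  | pred n ih =>
    have h := step (-n - 1)
    rw [sub_add_cancel, ih] at h
    rw [zpow_sub_one₀ hx0]
    field_simp
    linear_combination -h

theorem norm_pow_lt_one {q : ℂ} (hq : ‖q‖ < 1) {n : ℕ} (hn : n ≠ 0) : ‖q ^ n‖ < 1 := by
  rw [norm_pow]
  exact pow_lt_one₀ (norm_nonneg q) hq hn

theorem qPochInf_odd_mul {q : ℂ} (hq : ‖q‖ < 1) :
    qPochInf q (q ^ 2) * qPochInf (q ^ 2) (q ^ 2) = qPochInf q q := by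
  rw [qPochInf_even_odd hq q, ← pow_two]

theorem qPochInf_neg_mul {q : ℂ} (hq : ‖q‖ < 1) :
    qPochInf (-q) q * qPochInf q q = qPochInf (q ^ 2) (q ^ 2) := by
  rw [mul_comm, qPochInf_mul_neg hq]

/-- Split `(-q; q)_∞` into odd and even powers and apply Euler's `(-q; q)_∞ (q; q)_∞ = (q²; q²)_∞`
in bases `q` and `q ^ 2`. Several of the product evaluations below rest on this identity. -/
theorem qPochInf_neg_odd_mul {q : ℂ} (hq : ‖q‖ < 1) :
    qPochInf (-q) (q ^ 2) * (qPochInf q q * qPochInf (q ^ 4) (q ^ 4))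
      = qPochInf (q ^ 2) (q ^ 2) ^ 2 := by
  have h1 := qPochInf_neg_mul hq
  have h2 := qPochInf_neg_mul (norm_pow_lt_one hq two_ne_zero)
  rw [qPochInf_even_odd hq (-q), neg_mul, ← pow_two] at h1
  rw [← pow_mul] at h2
  norm_num at h2
  rw [← h2]
  linear_combination qPochInf (q ^ 2) (q ^ 2) * h1

/-- This theta value is the classical `φ(q) = ∑ q ^ (k ^ 2)`; the next one is `ψ(q) = ∑ q ^ (2 k ^ 2
+ k)`, both over `k ∈ ℤ`. -/
theorem theta_neg_sq {q : ℂ} (hq0 : q ≠ 0) (hq : ‖q‖ < 1) :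
    theta (-q) (q ^ 2) = qPochInf (q ^ 2) (q ^ 2) ^ 5 /
      (qPochInf q q ^ 2 * qPochInf (q ^ 4) (q ^ 4) ^ 2) := by
  have h1 := qPochInf_self_ne_zero hq
  have h4 := qPochInf_self_ne_zero (norm_pow_lt_one hq four_ne_zero)
  have h := qPochInf_neg_odd_mul hq
  rw [theta, show q ^ 2 / -q = -q by field_simp, eq_div_iff (by positivity)]
  linear_combination (qPochInf (-q) (q ^ 2) * qPochInf q q * qPochInf (q ^ 4) (q ^ 4) +
    qPochInf (q ^ 2) (q ^ 2) ^ 2) * qPochInf (q ^ 2) (q ^ 2) * h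

theorem theta_neg_fourth {q : ℂ} (hq0 : q ≠ 0) (hq : ‖q‖ < 1) :
    theta (-q) (q ^ 4) = qPochInf (q ^ 2) (q ^ 2) ^ 2 / qPochInf q q := by
  have h1 := qPochInf_self_ne_zero hq
  have h := qPochInf_neg_odd_mul hq
  rw [qPochInf_even_odd (norm_pow_lt_one hq two_ne_zero) (-q), ← pow_mul] at h
  rw [theta, eq_div_iff h1, ← h, show q ^ 4 / -q = -q * q ^ 2 by field_simp]
  ring

theorem theta_fourth {q : ℂ} (hq0 : q ≠ 0) (hq : ‖q‖ < 1) :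
    theta q (q ^ 4) = qPochInf q q * qPochInf (q ^ 4) (q ^ 4) / qPochInf (q ^ 2) (q ^ 2) := by
  have h1 := qPochInf_self_ne_zero (norm_pow_lt_one hq two_ne_zero)
  have h := qPochInf_odd_mul hq
  rw [qPochInf_even_odd (norm_pow_lt_one hq two_ne_zero) q, ← pow_mul] at h
  rw [theta, eq_div_iff h1, ← h, show q ^ 4 / q = q * q ^ 2 by field_simp]
  ring

theorem theta_sq_fourth {q : ℂ} (hq0 : q ≠ 0) (hq : ‖q‖ < 1) :
    theta (q ^ 2) (q ^ 4) = qPochInf (q ^ 2) (q ^ 2) ^ 2 / qPochInf (q ^ 4) (q ^ 4) := by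
  have h1 := qPochInf_self_ne_zero (norm_pow_lt_one hq four_ne_zero)
  have h := qPochInf_odd_mul (norm_pow_lt_one hq two_ne_zero)
  rw [← pow_mul] at h
  rw [theta, eq_div_iff h1, ← h, show q ^ 4 / q ^ 2 = q ^ 2 by field_simp]
  ring

theorem theta_neg_one {q : ℂ} (hq : ‖q‖ < 1) :
    theta (-1) q = 2 * qPochInf (q ^ 2) (q ^ 2) ^ 2 / qPochInf q q := by
  have h1 := qPochInf_self_ne_zero hq
  rw [theta, eq_div_iff h1, ← qPochInf_neg_mul hq, qPochInf_step hq (-1), div_neg, div_one,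
    neg_one_mul]
  ring

theorem theta_I_mul {q : ℂ} (hq0 : q ≠ 0) (hq : ‖q‖ < 1) :
    theta (Complex.I * q) (q ^ 2) = qPochInf (q ^ 4) (q ^ 4) ^ 2 / qPochInf (q ^ 8) (q ^ 8) := by
  have hq2 := norm_pow_lt_one hq two_ne_zero
  have h1 := qPochInf_self_ne_zero hq2
  have h8 := qPochInf_self_ne_zero (norm_pow_lt_one hq (n := 8) (by norm_num))
  have h := qPochInf_neg_odd_mul hq2
  simp only [← pow_mul] at h
  norm_num at h
  have hm := qPochInf_mul_neg hq2 (Complex.I * q)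
  rw [mul_pow, Complex.I_sq, neg_one_mul, ← pow_mul] at hm
  norm_num at hm
  rw [theta, eq_div_iff h8, ← h, ← hm, show q ^ 2 / (Complex.I * q) = -(Complex.I * q) by
    field_simp; rw [Complex.I_sq]; ring]
  ring

theorem theta_neg_I_mul_sq {q : ℂ} (hq0 : q ≠ 0) (hq : ‖q‖ < 1) :
    theta (-(Complex.I * q ^ 2)) (q ^ 4)
      = qPochInf (q ^ 8) (q ^ 8) ^ 2 / qPochInf (q ^ 16) (q ^ 16) := by
  -- The substitution `q ↦ -q ^ 2` changes the sign of the argument only, since every other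
  -- occurrence of the base has even exponent.
  have h := theta_I_mul (q := -q ^ 2) (neg_ne_zero.2 (pow_ne_zero 2 hq0))
    (by rw [norm_neg]; exact norm_pow_lt_one hq two_ne_zero)
  rw [mul_neg, Even.neg_pow (by decide), Even.neg_pow (by decide), Even.neg_pow (by decide)] at h
  simp only [← pow_mul] at h
  exact h

theorem theta_neg_I {q : ℂ} (hq : ‖q‖ < 1) :
    theta (-Complex.I) q
      = (1 + Complex.I) * qPochInf (q ^ 4) (q ^ 4) * qPochInf q q / qPochInf (q ^ 2) (q ^ 2) := by
  have hq2 := norm_pow_lt_one hq two_ne_zero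
  have h1 := qPochInf_self_ne_zero hq2
  have h := qPochInf_neg_mul hq2
  have hm := qPochInf_mul_neg hq (Complex.I * q)
  rw [mul_pow, Complex.I_sq, neg_one_mul] at hm
  rw [← pow_mul, ← hm] at h
  rw [theta, eq_div_iff h1, qPochInf_step hq (-Complex.I), div_neg, Complex.div_I, neg_neg,
    ← h, neg_mul, mul_comm q]
  ring

theorem triWeight_mul_neg_zpow (q x : ℂ) (k : ℤ) :
    triWeight q k * (-x) ^ (-k) = q ^ tri k * x ^ (-k) := by
  rw [triWeight, neg_eq_neg_one_mul x, mul_zpow, mul_mul_mul_comm, ← zpow_add₀ (by norm_num),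
    add_neg_cancel, zpow_zero, one_mul]

theorem hasSum_int_even_add_odd {f : ℤ → ℂ} {a b : ℂ} (he : HasSum (fun k => f (2 * k)) a)
    (ho : HasSum (fun k => f (2 * k + 1)) b) : HasSum f (a + b) := by
  have h2 : Function.Injective fun k : ℤ => 2 * k := fun a b h => by simpa using h
  have h3 : Function.Injective fun k : ℤ => 2 * k + 1 := fun a b h => by simpa using h
  have hc : IsCompl (Set.range fun k : ℤ => 2 * k) (Set.range fun k : ℤ => 2 * k + 1) := by
    have : (Set.range fun k : ℤ => 2 * k) = {n | Even n} := by
      ext n; simp [even_iff_exists_two_mul]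
    rw [this]
    have : (Set.range fun k : ℤ => 2 * k + 1) = {n | Odd n} := by
      ext n; simp [Odd]
    rw [this]
    exact Int.isCompl_even_odd
  exact (h2.hasSum_range_iff.2 he).add_isCompl hc (h3.hasSum_range_iff.2 ho)

/-- The two-dissection `φ(q) = φ(q⁴) + 2 q ψ(q⁸)` of the classical theta series. -/
theorem theta_neg_sq_dissection {q : ℂ} (hq0 : q ≠ 0) (hq : ‖q‖ < 1) :
    theta (-q) (q ^ 2) = theta (-q ^ 4) (q ^ 8) + q * theta (-1) (q ^ 8) := by
  have h1 := hasSum_theta (x := -q) (neg_ne_zero.2 hq0) (pow_ne_zero 2 hq0)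
    (norm_pow_lt_one hq two_ne_zero)
  have h2 := hasSum_theta (x := -q ^ 4) (neg_ne_zero.2 (pow_ne_zero 4 hq0)) (pow_ne_zero 8 hq0)
    (norm_pow_lt_one hq (by norm_num))
  have h3 := (hasSum_theta (x := -1) (by norm_num) (pow_ne_zero 8 hq0)
    (norm_pow_lt_one hq (by norm_num))).mul_left q
  -- The series is `∑ q ^ (k ^ 2)`; even `k` give exponents `4 k ^ 2`, odd ones `4 k (k + 1) + 1`.
  refine h1.unique (hasSum_int_even_add_odd (h2.of_eq (fun k => ?_) rfl) (h3.of_eq (fun k => ?_) rfl))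
  · have e := two_mul_tri k
    rw [triWeight_mul_neg_zpow, triWeight_mul_neg_zpow, ← zpow_natCast, ← zpow_natCast,
      ← zpow_natCast, ← zpow_mul, ← zpow_mul, ← zpow_mul,
      ← zpow_add₀ hq0, ← zpow_add₀ hq0, tri_two_mul]
    congr 1
    push_cast
    linear_combination -4 * e
  · have e := two_mul_tri k
    rw [triWeight_mul_neg_zpow, triWeight_mul_neg_zpow, one_zpow, mul_one, ← zpow_natCast,
      ← zpow_natCast, ← zpow_mul, ← zpow_mul, ← zpow_add₀ hq0, ← zpow_one_add₀ hq0, tri_add_one,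
      tri_two_mul]
    congr 1
    push_cast
    linear_combination -4 * e

theorem qPochInf_trisection {q : ℂ} (hq : ‖q‖ < 1) (a : ℂ) :
    qPochInf a q = qPochInf a (q ^ 3) * qPochInf (a * q) (q ^ 3) * qPochInf (a * q ^ 2) (q ^ 3) := by
  have hq3 := norm_pow_lt_one hq three_ne_zero
  have h3 : Tendsto (fun n : ℕ => 3 * n) atTop atTop :=
    tendsto_id.const_mul_atTop' (by norm_num)
  refine tendsto_nhds_unique ((tendsto_qPoch hq a).comp h3) ?_
  refine (((tendsto_qPoch hq3 a).mul (tendsto_qPoch hq3 (a * q))).mul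
    (tendsto_qPoch hq3 (a * q ^ 2))).congr fun n => ?_
  induction n with
  | zero => simp [qPoch]
  | succ n ih =>
    simp only [Function.comp_apply] at ih ⊢
    rw [show 3 * (n + 1) = 3 * n + 1 + 1 + 1 by ring, qPoch_succ a q, qPoch_succ a q,
      qPoch_succ a q, ← ih, qPoch_succ, qPoch_succ, qPoch_succ]
    ring

/-- **Pentagonal number theorem**, as a bilateral series. -/
theorem hasSum_pentagonal {q : ℂ} (hq0 : q ≠ 0) (hq : ‖q‖ < 1) :
    HasSum (fun k : ℤ => cubicWeight q k * q ^ (-k)) (qPochInf q q) := by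
  have h := hasSum_theta hq0 (pow_ne_zero 3 hq0) (norm_pow_lt_one hq three_ne_zero)
  refine h.of_eq (fun k => ?_) ?_
  · rw [cubicWeight, triWeight, ← zpow_natCast, ← zpow_mul]
    norm_num
  · rw [theta, qPochInf_trisection hq q, ← pow_two, ← pow_succ', show q ^ 3 / q = q ^ 2 by field_simp]

/-! ### Changing the base from `q` to `q ^ 4` by a product of two partial fraction expansions. -/

/-- The Appell sum `∑_k (-1) ^ k q ^ (3 k (k + 1) / 2) / (1 - X q ^ (2 k))`. -/
noncomputable def evenAppellSum (X q : ℂ) : ℂ :=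
  ∑' k : ℤ, cubicWeight q k / (1 - X * q ^ (2 * k))

theorem zpow_two_mul' (q : ℂ) (k : ℤ) : q ^ (2 * k) = (q ^ 2) ^ k := by
  rw [zpow_mul]; norm_cast

theorem zpow_four_mul' (q : ℂ) (k : ℤ) : q ^ (4 * k) = (q ^ 4) ^ k := by
  rw [zpow_mul]; norm_cast

theorem summable_evenAppellSum {X q : ℂ} (hX0 : X ≠ 0) (hq0 : q ≠ 0) (hq : ‖q‖ < 1) :
    Summable fun k : ℤ => cubicWeight q k / (1 - X * q ^ (2 * k)) := by
  obtain ⟨B, -, hB⟩ := exists_norm_inv_one_sub_le hX0 (pow_ne_zero 2 hq0)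
    (norm_pow_lt_one hq two_ne_zero)
  refine summable_mul_of_norm_le (B := B) (summable_norm_cubicWeight hq0 hq) fun k => ?_
  rw [zpow_two_mul']
  exact hB k

theorem neg_mul_zpow_ne_one {q : ℂ} (hq : ‖q‖ < 1) {n : ℤ} (hn : n ≠ 0) : -(q ^ n) ≠ 1 := by
  intro h
  have h1 := congrArg norm h
  rw [norm_neg, norm_zpow, norm_one] at h1
  exact hn ((zpow_eq_one_iff_right₀ (norm_nonneg q) hq.ne).1 h1)

theorem zpow_tri_mul_theta_neg {x q : ℂ} (hx0 : x ≠ 0) (hq0 : q ≠ 0) (hq : ‖q‖ < 1) (n : ℤ) :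
    q ^ tri n * theta (-x * q ^ (-n)) q = x ^ n * theta (-x) q := by
  have h := triWeight_mul_theta (neg_ne_zero.2 hx0) hq0 hq n
  have hn : (-1 : ℂ) ^ n ≠ 0 := zpow_ne_zero n (by norm_num)
  apply mul_left_cancel₀ hn
  rw [← mul_assoc, ← triWeight, h, ← mul_assoc, ← mul_zpow, neg_one_mul]

/-- The theta values `θ(-q ^ (1 - 2 m); q ^ 4)` are monomial multiples of one another. -/
theorem theta_neg_odd {q : ℂ} (hq0 : q ≠ 0) (hq : ‖q‖ < 1) (m : ℤ) :
    q ^ tri m * theta (-q * q ^ (-2 * m)) (q ^ 4) = theta (-q) (q ^ 4) := by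
  have hq40 : q ^ 4 ≠ 0 := pow_ne_zero 4 hq0
  have hq4 : ‖q ^ 4‖ < 1 := norm_pow_lt_one hq four_ne_zero
  -- A shift by `q ^ (-2 m)` is an integral number of base steps `q ^ 4` only for even `m`; odd `m`
  -- start from `-q⁻¹`, which `theta_div` links to `-q`.
  obtain ⟨n, rfl | rfl⟩ := m.even_or_odd'
  · have h' := zpow_tri_mul_theta_neg hq0 hq40 hq4 n
    rw [← zpow_four_mul', ← zpow_four_mul'] at h'
    have hn : q ^ n ≠ 0 := zpow_ne_zero n hq0
    apply mul_left_cancel₀ hn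
    rw [← h', ← mul_assoc, ← zpow_add₀ hq0, tri_two_mul]
    have e := two_mul_tri n
    congr 2
    · linear_combination -2 * e
    · ring_nf
  · have hb : theta (-q⁻¹) (q ^ 4) = q⁻¹ * theta (-q) (q ^ 4) := by
      have h1 := theta_mul (x := -q⁻¹) (neg_ne_zero.2 (inv_ne_zero hq0)) hq40 hq4
      rw [show -q⁻¹ * q ^ 4 = q ^ 4 / (-q) by field_simp, theta_div hq40, inv_neg, inv_inv,
        neg_neg] at h1
      rw [h1]
      field_simp
    have h' := zpow_tri_mul_theta_neg (inv_ne_zero hq0) hq40 hq4 n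
    rw [← zpow_four_mul', ← zpow_four_mul', hb, ← zpow_neg_one, ← zpow_mul, ← mul_assoc,
      ← zpow_add₀ hq0, neg_mul, ← zpow_add₀ hq0] at h'
    have hn : q ^ (-1 * n + -1) ≠ 0 := zpow_ne_zero _ hq0
    apply mul_left_cancel₀ hn
    rw [← h', ← mul_assoc, ← zpow_add₀ hq0, tri_add_one, tri_two_mul, neg_mul q,
      ← zpow_one_add₀ hq0]
    have e := two_mul_tri n
    congr 2
    · linear_combination -2 * e
    · ring_nf

theorem theta_neg_inv {q : ℂ} (hq0 : q ≠ 0) (hq : ‖q‖ < 1) (n : ℤ) :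
    (q ^ 4) ^ (2 * tri n) * theta (-q⁻¹ * q ^ (-4 * n)) (q ^ 2) = q⁻¹ * theta (-q) (q ^ 2) := by
  have hq20 : q ^ 2 ≠ 0 := pow_ne_zero 2 hq0
  have hq2 : ‖q ^ 2‖ < 1 := norm_pow_lt_one hq two_ne_zero
  have hb : theta (-q⁻¹) (q ^ 2) = q⁻¹ * theta (-q) (q ^ 2) := by
    have h1 := theta_mul (x := -q⁻¹) (neg_ne_zero.2 (inv_ne_zero hq0)) hq20 hq2
    rw [show -q⁻¹ * q ^ 2 = -q by field_simp, inv_neg, inv_inv, neg_neg] at h1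
    rw [h1]
    field_simp
  have h := triWeight_mul_theta (x := -q⁻¹) (neg_ne_zero.2 (inv_ne_zero hq0)) hq20 hq2 (2 * n)
  rw [triWeight, (even_two_mul n).neg_one_zpow, (even_two_mul n).neg_zpow, one_mul, hb,
    ← zpow_two_mul', ← zpow_two_mul', ← zpow_neg_one, ← zpow_mul] at h
  have hn : q ^ (-1 * (2 * n)) ≠ 0 := zpow_ne_zero _ hq0
  apply mul_left_cancel₀ hn
  rw [← zpow_neg_one, ← h, ← zpow_four_mul', ← mul_assoc, ← zpow_add₀ hq0, tri_two_mul]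
  have e := two_mul_tri n
  congr 2
  · linear_combination 4 * e
  · ring_nf

theorem inv_one_sub_mul_inv_one_sub {u v : ℂ} (hu0 : u ≠ 0) (hv0 : v ≠ 0) (huv : u ≠ v)
    (hu : 1 - u ≠ 0) (hv : 1 - v ≠ 0) :
    1 / (1 - u) * (1 / (1 - v))
      = 1 / (1 - u) * (1 / (1 - v / u)) + 1 / (1 - v) * (1 / (1 - u / v)) := by
  have h1 : u - v ≠ 0 := sub_ne_zero.2 huv
  have h2 : v - u ≠ 0 := sub_ne_zero.2 huv.symm
  rw [show 1 - v / u = (u - v) / u by field_simp, show 1 - u / v = (v - u) / v by field_simp,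
    show v - u = -(u - v) by ring]
  field_simp
  ring

/-- With `u = X * q ^ (2 m)` and `v = -(q * X) * q ^ (4 n)`, the ratio `v / u` does not involve `X`.
So in each of the two pieces one index can be summed out by `hasSum_theta_inv` at a point
independent of `X`. -/
theorem split_product_term {X q : ℂ} (hX0 : X ≠ 0) (hq0 : q ≠ 0) (hq : ‖q‖ < 1)
    (hX : ∀ k : ℤ, X * (q ^ 2) ^ k ≠ 1) (hY : ∀ k : ℤ, -(q * X) * (q ^ 4) ^ k ≠ 1) (m n : ℤ) :
    triWeight (q ^ 2) m / (1 - X * (q ^ 2) ^ m) *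
        (triWeight (q ^ 4) n / (1 - -(q * X) * (q ^ 4) ^ n))
      = triWeight (q ^ 2) m * triWeight (q ^ 4) n *
          ((1 - X * (q ^ 2) ^ m)⁻¹ * (1 - -q * (q ^ 2) ^ (2 * n - m))⁻¹)
        + triWeight (q ^ 2) m * triWeight (q ^ 4) n *
          ((1 - -(q * X) * (q ^ 4) ^ n)⁻¹ * (1 - -q⁻¹ * (q ^ 2) ^ (m - 2 * n))⁻¹) := by
  have hq20 : q ^ 2 ≠ 0 := pow_ne_zero 2 hq0
  have hq40 : q ^ 4 ≠ 0 := pow_ne_zero 4 hq0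
  have hY0 : -(q * X) ≠ 0 := neg_ne_zero.2 (mul_ne_zero hq0 hX0)
  have hu0 : X * (q ^ 2) ^ m ≠ 0 := mul_ne_zero hX0 (zpow_ne_zero _ hq20)
  have hv0 : -(q * X) * (q ^ 4) ^ n ≠ 0 := mul_ne_zero hY0 (zpow_ne_zero _ hq40)
  have e4 : (q ^ 4) ^ n = (q ^ 2) ^ (2 * n) := by
    rw [zpow_mul]; congr 1; norm_cast; ring
  have hvu : -(q * X) * (q ^ 4) ^ n / (X * (q ^ 2) ^ m) = -q * (q ^ 2) ^ (2 * n - m) := by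
    rw [zpow_sub₀ hq20, e4]
    field_simp
  have huv : X * (q ^ 2) ^ m / (-(q * X) * (q ^ 4) ^ n) = -q⁻¹ * (q ^ 2) ^ (m - 2 * n) := by
    rw [zpow_sub₀ hq20, e4]
    field_simp
  -- Equality would make minus an odd power of `q` equal to 1.
  have hne : X * (q ^ 2) ^ m ≠ -(q * X) * (q ^ 4) ^ n := by
    intro h
    rw [← h, div_self hu0, ← zpow_two_mul', neg_mul, ← zpow_one_add₀ hq0] at hvu
    exact neg_mul_zpow_ne_one hq (by omega) hvu.symm
  have := inv_one_sub_mul_inv_one_sub hu0 hv0 hne (sub_ne_zero.2 (hX _).symm)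
    (sub_ne_zero.2 (hY _).symm)
  rw [hvu, huv] at this
  linear_combination (triWeight (q ^ 2) m * triWeight (q ^ 4) n) * this

/-- The inner sum is a reciprocal theta value at `-q ^ (1 - 2 m)`; by `theta_neg_odd` it carries `q
^ tri m`, completing the weight `q ^ (2 * tri m)` to the cubic one. -/
theorem hasSum_product_row {X q : ℂ} (hq0 : q ≠ 0) (hq : ‖q‖ < 1) (m : ℤ) :
    HasSum (fun n => triWeight (q ^ 2) m * triWeight (q ^ 4) n *
        ((1 - X * (q ^ 2) ^ m)⁻¹ * (1 - -q * (q ^ 2) ^ (2 * n - m))⁻¹))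
      (qPochInf (q ^ 4) (q ^ 4) ^ 3 / theta (-q) (q ^ 4) *
        (cubicWeight q m / (1 - X * q ^ (2 * m)))) := by
  have hq40 : q ^ 4 ≠ 0 := pow_ne_zero 4 hq0
  have hq4 : ‖q ^ 4‖ < 1 := norm_pow_lt_one hq four_ne_zero
  have hx0 : -q * q ^ (-2 * m) ≠ 0 := mul_ne_zero (neg_ne_zero.2 hq0) (zpow_ne_zero _ hq0)
  have hx : ∀ k : ℤ, -q * q ^ (-2 * m) * (q ^ 4) ^ k ≠ 1 := by
    intro k
    rw [neg_mul, ← zpow_one_add₀ hq0, ← zpow_four_mul', neg_mul, ← zpow_add₀ hq0]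
    exact neg_mul_zpow_ne_one hq (by omega)
  have h := (hasSum_theta_inv hx0 hq40 hq4 hx).mul_left
    (triWeight (q ^ 2) m / (1 - X * (q ^ 2) ^ m))
  refine h.of_eq (fun n => ?_) ?_
  · rw [show -q * (q ^ 2) ^ (2 * n - m) = -q * q ^ (-2 * m) * (q ^ 4) ^ n by
      rw [← zpow_two_mul', ← zpow_four_mul', mul_assoc, ← zpow_add₀ hq0]; ring_nf]
    ring
  · have ht := theta_neg_odd hq0 hq m
    have hq' : q ^ tri m ≠ 0 := zpow_ne_zero _ hq0
    have ht0 := theta_ne_zero hx0 hq40 hq4 hx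
    rw [← ht, cubicWeight, triWeight, ← zpow_two_mul', ← zpow_two_mul',
      show q ^ (3 * tri m) = q ^ (2 * tri m) * q ^ tri m by rw [← zpow_add₀ hq0]; ring_nf]
    field_simp

/-- The counterpart in the other index: `theta_neg_inv` supplies the factor that makes the weight
cubic in base `q ^ 4`. -/
theorem hasSum_product_column {X q : ℂ} (hq0 : q ≠ 0) (hq : ‖q‖ < 1) (n : ℤ) :
    HasSum (fun m => triWeight (q ^ 2) m * triWeight (q ^ 4) n *
        ((1 - -(q * X) * (q ^ 4) ^ n)⁻¹ * (1 - -q⁻¹ * (q ^ 2) ^ (m - 2 * n))⁻¹))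
      (qPochInf (q ^ 2) (q ^ 2) ^ 3 * q / theta (-q) (q ^ 2) *
        (cubicWeight (q ^ 4) n / (1 - -(q * X) * (q ^ 4) ^ n))) := by
  have hq20 : q ^ 2 ≠ 0 := pow_ne_zero 2 hq0
  have hq2 : ‖q ^ 2‖ < 1 := norm_pow_lt_one hq two_ne_zero
  have hx0 : -q⁻¹ * q ^ (-4 * n) ≠ 0 :=
    mul_ne_zero (neg_ne_zero.2 (inv_ne_zero hq0)) (zpow_ne_zero _ hq0)
  have hx : ∀ k : ℤ, -q⁻¹ * q ^ (-4 * n) * (q ^ 2) ^ k ≠ 1 := by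
    intro k
    rw [← zpow_neg_one, neg_mul, ← zpow_add₀ hq0, ← zpow_two_mul', neg_mul, ← zpow_add₀ hq0]
    exact neg_mul_zpow_ne_one hq (by omega)
  have h := (hasSum_theta_inv hx0 hq20 hq2 hx).mul_left
    (triWeight (q ^ 4) n / (1 - -(q * X) * (q ^ 4) ^ n))
  refine h.of_eq (fun m => ?_) ?_
  · rw [show -q⁻¹ * (q ^ 2) ^ (m - 2 * n) = -q⁻¹ * q ^ (-4 * n) * (q ^ 2) ^ m by
      rw [← zpow_two_mul', ← zpow_two_mul', mul_assoc, ← zpow_add₀ hq0]; ring_nf]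
    ring
  · have ht := theta_neg_inv hq0 hq n
    have hq' : (q ^ 4) ^ (2 * tri n) ≠ 0 := zpow_ne_zero _ (pow_ne_zero 4 hq0)
    have ht0 := theta_ne_zero hx0 hq20 hq2 hx
    have ht1 : theta (-q) (q ^ 2)
        = q * ((q ^ 4) ^ (2 * tri n) * theta (-q⁻¹ * q ^ (-4 * n)) (q ^ 2)) := by
      rw [ht]; field_simp
    rw [ht1, cubicWeight_eq]
    field_simp

theorem summable_product_bounded {a b : ℤ → ℂ} {g h : ℤ × ℤ → ℂ} {B C : ℝ}
    (ha : Summable fun m => ‖a m‖) (hb : Summable fun n => ‖b n‖)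
    (hB : 0 ≤ B) (hg : ∀ p, ‖g p‖ ≤ B) (hh : ∀ p, ‖h p‖ ≤ C) :
    Summable fun p : ℤ × ℤ => a p.1 * b p.2 * (g p * h p) := by
  have hW := ha.mul_of_nonneg hb (fun _ => norm_nonneg _) (fun _ => norm_nonneg _)
  have hW' : Summable fun p : ℤ × ℤ => ‖a p.1 * b p.2‖ := by simpa only [norm_mul] using hW
  refine summable_mul_of_norm_le (B := B * C) hW' fun p => ?_
  rw [norm_mul]
  exact mul_le_mul (hg _) (hh _) (norm_nonneg _) hB

theorem hasSum_product {ι κ : Type*} {f : ι → ℂ} {g : κ → ℂ} {a b : ℂ} (hf : HasSum f a) (hg : HasSum g b) :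
    HasSum (fun p : ι × κ => f p.1 * g p.2) (a * b) :=
  hf.mul hg (summable_mul_of_summable_norm hf.summable.norm hg.summable.norm)

theorem partialFraction_theta_mul_theta {X q : ℂ} (hX0 : X ≠ 0) (hq0 : q ≠ 0) (hq : ‖q‖ < 1)
    (hX : ∀ k : ℤ, X * (q ^ 2) ^ k ≠ 1) (hY : ∀ k : ℤ, -(q * X) * (q ^ 4) ^ k ≠ 1) :
    qPochInf (q ^ 2) (q ^ 2) ^ 3 / theta X (q ^ 2) *
        (qPochInf (q ^ 4) (q ^ 4) ^ 3 / theta (-(q * X)) (q ^ 4))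
      = qPochInf (q ^ 4) (q ^ 4) ^ 3 / theta (-q) (q ^ 4) * evenAppellSum X q
        + qPochInf (q ^ 2) (q ^ 2) ^ 3 * q / theta (-q) (q ^ 2) *
          appellSum (-(q * X)) (q ^ 4) := by
  have hq20 : q ^ 2 ≠ 0 := pow_ne_zero 2 hq0
  have hq40 : q ^ 4 ≠ 0 := pow_ne_zero 4 hq0
  have hq2 : ‖q ^ 2‖ < 1 := norm_pow_lt_one hq two_ne_zero
  have hq4 : ‖q ^ 4‖ < 1 := norm_pow_lt_one hq four_ne_zero
  have hY0 : -(q * X) ≠ 0 := neg_ne_zero.2 (mul_ne_zero hq0 hX0)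
  have hf := hasSum_theta_inv hX0 hq20 hq2 hX
  have hg := hasSum_theta_inv hY0 hq40 hq4 hY
  obtain ⟨B1, hB10, hB1⟩ := exists_norm_inv_one_sub_le hX0 hq20 hq2
  obtain ⟨B2, hB20, hB2⟩ := exists_norm_inv_one_sub_le hY0 hq40 hq4
  obtain ⟨B3, hB30, hB3⟩ := exists_norm_inv_one_sub_le (neg_ne_zero.2 hq0) hq20 hq2
  obtain ⟨B4, hB40, hB4⟩ :=
    exists_norm_inv_one_sub_le (neg_ne_zero.2 (inv_ne_zero hq0)) hq20 hq2
  have hw2 := summable_norm_triWeight hq20 hq2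
  have hw4 := summable_norm_triWeight hq40 hq4
  have hS1 := summable_product_bounded (g := fun p => (1 - X * (q ^ 2) ^ p.1)⁻¹)
    (h := fun p => (1 - -q * (q ^ 2) ^ (2 * p.2 - p.1))⁻¹) hw2 hw4 hB10 (fun p => hB1 p.1)
    (fun p => hB3 (2 * p.2 - p.1))
  have hS2 := summable_product_bounded (g := fun p => (1 - -(q * X) * (q ^ 4) ^ p.2)⁻¹)
    (h := fun p => (1 - -q⁻¹ * (q ^ 2) ^ (p.1 - 2 * p.2))⁻¹) hw2 hw4 hB20 (fun p => hB2 p.2)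
    (fun p => hB4 (p.1 - 2 * p.2))
  have hprod := hasSum_product hf hg
  have h1 := (hS1.hasSum.prod_fiberwise fun m => hasSum_product_row hq0 hq m).unique
    ((summable_evenAppellSum hX0 hq0 hq).hasSum.mul_left _)
  have h2 := ((Equiv.prodComm ℤ ℤ).hasSum_iff.2 hS2.hasSum |>.prod_fiberwise
    fun n => hasSum_product_column hq0 hq n).unique
    ((summable_appellSum hY0 hq40 hq4).hasSum.mul_left _)
  have h3 := (hS1.hasSum.add hS2.hasSum).of_eq
    (fun p => split_product_term hX0 hq0 hq hX hY p.1 p.2) rfl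
  rw [hprod.unique h3, h1, h2, evenAppellSum, appellSum]

/-- The even part of the universal mock theta function in terms of its value at base `q ^ 4`. -/
theorem evenAppellSum_div {X q : ℂ} (hX0 : X ≠ 0) (hq0 : q ≠ 0) (hq : ‖q‖ < 1)
    (hX : ∀ k : ℤ, X * (q ^ 2) ^ k ≠ 1) (hY : ∀ k : ℤ, -(q * X) * (q ^ 4) ^ k ≠ 1) :
    evenAppellSum X q / qPochInf q q
      = theta (-q) (q ^ 2) * qPochInf (q ^ 4) (q ^ 4) ^ 2
          / (theta X (q ^ 2) * theta (-(q * X)) (q ^ 4))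
        - q * (appellSum (-(q * X)) (q ^ 4) / qPochInf (q ^ 4) (q ^ 4)) := by
  have h := partialFraction_theta_mul_theta hX0 hq0 hq hX hY
  have h1 := qPochInf_self_ne_zero hq
  have h2 := qPochInf_self_ne_zero (norm_pow_lt_one hq two_ne_zero)
  have h4 := qPochInf_self_ne_zero (norm_pow_lt_one hq four_ne_zero)
  have hA := theta_ne_zero hX0 (pow_ne_zero 2 hq0) (norm_pow_lt_one hq two_ne_zero)
    hX
  have hB := theta_ne_zero (neg_ne_zero.2 (mul_ne_zero hq0 hX0)) (pow_ne_zero 4 hq0)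
    (norm_pow_lt_one hq four_ne_zero) hY
  rw [theta_neg_sq hq0 hq, theta_neg_fourth hq0 hq] at h
  rw [theta_neg_sq hq0 hq]
  generalize theta X (q ^ 2) = A at *
  generalize theta (-(q * X)) (q ^ 4) = B at *
  generalize evenAppellSum X q = G at *
  generalize appellSum (-(q * X)) (q ^ 4) = L at *
  generalize qPochInf q q = E1 at *
  generalize qPochInf (q ^ 2) (q ^ 2) = E2 at *
  generalize qPochInf (q ^ 4) (q ^ 4) = E4 at *
  field_simp at h ⊢
  linear_combination -h

/-! ### The odd part of the Appell sum, special points, and the eight-dissection. -/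

/-- The Appell sum `∑_k (-1) ^ k q ^ (3 k (k + 1) / 2 + k) / (1 - X q ^ (2 k))`. -/
noncomputable def oddAppellSum (X q : ℂ) : ℂ :=
  ∑' k : ℤ, cubicWeight q k * q ^ k / (1 - X * q ^ (2 * k))

theorem unit_mul_zpow_ne_one {c q : ℂ} (hc : ‖c‖ = 1) (hq : ‖q‖ < 1) {n : ℤ} (hn : n ≠ 0) :
    c * q ^ n ≠ 1 := by
  intro h
  have h1 := congrArg norm h
  rw [norm_mul, hc, one_mul, norm_zpow, norm_one] at h1
  exact hn ((zpow_eq_one_iff_right₀ (norm_nonneg q) hq.ne).1 h1)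

theorem unit_mul_zpow_ne_one' {c q : ℂ} (hc : ‖c‖ = 1) (hc1 : c ≠ 1) (hq : ‖q‖ < 1) (n : ℤ) :
    c * q ^ n ≠ 1 := by
  rcases eq_or_ne n 0 with rfl | hn
  · simpa using hc1
  · exact unit_mul_zpow_ne_one hc hq hn

theorem cubicWeight_add_one {q : ℂ} (hq0 : q ≠ 0) (k : ℤ) :
    cubicWeight q (k + 1) = -cubicWeight q k * q ^ (3 * (k + 1)) := by
  rw [cubicWeight, cubicWeight, tri_add_one, mul_add, zpow_add₀ hq0,
    zpow_add₀ (by norm_num : (-1 : ℂ) ≠ 0)]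
  simp
  ring

theorem cubicWeight_neg {q : ℂ} (hq0 : q ≠ 0) (k : ℤ) :
    cubicWeight q (-k) = cubicWeight q k * q ^ (-3 * k) := by
  rw [cubicWeight, cubicWeight, tri_neg, mul_sub, zpow_sub₀ hq0, neg_mul, zpow_neg, zpow_neg,
    ← inv_zpow, inv_neg, inv_one]
  ring

theorem tsum_eq_zero_of_reflect {f : ℤ → ℂ} (hf : ∀ k, f (-1 - k) = -f k) : ∑' k, f k = 0 := by
  have h := (Equiv.subLeft (-1 : ℤ)).tsum_eq f
  simp only [Equiv.subLeft_apply, hf, tsum_neg] at h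
  exact self_eq_neg.1 h.symm

/-- With `u = x * q ^ k`, this is `1 / (1 - u) - 1 / (1 - u ^ 2) = u / (1 - u ^ 2)`, which also
gives the convergence of the odd part. -/
theorem hasSum_oddAppellSum {x q : ℂ} (hx0 : x ≠ 0) (hq0 : q ≠ 0) (hq : ‖q‖ < 1)
    (hx : ∀ k : ℤ, x ^ 2 * q ^ (2 * k) ≠ 1) :
    HasSum (fun k : ℤ => cubicWeight q k * q ^ k / (1 - x ^ 2 * q ^ (2 * k)))
      ((appellSum x q - evenAppellSum (x ^ 2) q) / x) := by
  have h := ((summable_appellSum hx0 hq0 hq).hasSum.sub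
    (summable_evenAppellSum (pow_ne_zero 2 hx0) hq0 hq).hasSum).div_const x
  refine h.of_eq (fun k => ?_) rfl
  have h1 := sub_ne_zero.2 (hx k).symm
  obtain ⟨u, hu⟩ : ∃ u, u = x * q ^ k := ⟨_, rfl⟩
  have e : x ^ 2 * q ^ (2 * k) = u ^ 2 := by
    rw [hu, mul_pow, zpow_mul', zpow_ofNat]
  have hk : q ^ k = u / x := by rw [hu]; field_simp
  have h2 : (1 - u) * (1 + u) = 1 - u ^ 2 := by ring
  rw [e, ← h2] at h1
  rw [e, ← hu, hk, ← h2]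
  have h3 := left_ne_zero_of_mul h1
  have h4 := right_ne_zero_of_mul h1
  field_simp
  ring

theorem appellSum_eq_even_add_odd {x q : ℂ} (hx0 : x ≠ 0) (hq0 : q ≠ 0) (hq : ‖q‖ < 1)
    (hx : ∀ k : ℤ, x ^ 2 * q ^ (2 * k) ≠ 1) :
    appellSum x q = evenAppellSum (x ^ 2) q + x * oddAppellSum (x ^ 2) q := by
  rw [oddAppellSum, (hasSum_oddAppellSum hx0 hq0 hq hx).tsum_eq]
  field_simp
  ring

/-- Reflect `k ↦ -1 - k` and use `1 / (1 - u⁻¹) = 1 - 1 / (1 - u)`; the constant part drops out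
because the cubic weights are antisymmetric and sum to zero. -/
theorem appellSum_div {x q : ℂ} (hx0 : x ≠ 0) (hq0 : q ≠ 0) (hq : ‖q‖ < 1)
    (hx : ∀ k : ℤ, x * q ^ k ≠ 1) : appellSum (q / x) q = appellSum x q := by
  have h0 : ∑' k : ℤ, cubicWeight q k = 0 := tsum_eq_zero_of_reflect (cubicWeight_reflect q)
  have h1 := (summable_norm_cubicWeight hq0 hq).of_norm.hasSum
  rw [h0] at h1
  have h2 := (summable_appellSum hx0 hq0 hq).hasSum.sub h1
  rw [sub_zero] at h2
  rw [appellSum, ← (Equiv.subLeft (-1 : ℤ)).tsum_eq]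
  refine (h2.of_eq (fun k => ?_) rfl).tsum_eq
  simp only [Equiv.subLeft_apply]
  have hk : q ^ k ≠ 0 := zpow_ne_zero k hq0
  have h3 := sub_ne_zero.2 (hx k).symm
  have e : q / x * q ^ (-1 - k) = (x * q ^ k)⁻¹ := by
    rw [zpow_sub₀ hq0, zpow_neg_one]
    field_simp
  have hu : x * q ^ k ≠ 0 := mul_ne_zero hx0 hk
  rw [cubicWeight_reflect, e]
  generalize x * q ^ k = u at *
  have h4 : u - 1 ≠ 0 := fun h => h3 (by linear_combination -h)
  rw [show 1 - u⁻¹ = (u - 1) / u by field_simp]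
  field_simp
  ring

theorem oddAppellSum_neg_self {q : ℂ} (hq0 : q ≠ 0) (hq : ‖q‖ < 1) : oddAppellSum (-q) q = 0 := by
  refine tsum_eq_zero_of_reflect fun k => ?_
  have h1 : 1 - -q * q ^ (2 * k) ≠ 0 := by
    rw [neg_mul, ← zpow_one_add₀ hq0]
    exact sub_ne_zero.2 (neg_mul_zpow_ne_one hq (by omega)).symm
  have hk : q ^ k ≠ 0 := zpow_ne_zero k hq0
  have e1 : q ^ (-1 - k) = q⁻¹ * (q ^ k)⁻¹ := by rw [zpow_sub₀ hq0, zpow_neg_one]; rfl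
  have e2 : ∀ m : ℤ, q ^ (2 * m) = (q ^ m) ^ 2 := fun m => by rw [zpow_mul', zpow_ofNat]
  rw [e2] at h1
  rw [cubicWeight_reflect, e2, e2, e1]
  generalize q ^ k = y at *
  have h2 : q * y ^ 2 + 1 ≠ 0 := fun h => h1 (by linear_combination h)
  rw [show 1 - -q * (q⁻¹ * y⁻¹) ^ 2 = (q * y ^ 2 + 1) / (q * y ^ 2) by field_simp; ring,
    show 1 - -q * y ^ 2 = q * y ^ 2 + 1 by ring]
  field_simp

/-- After `k ↦ -k` in the even sum, the two numerators add up to `q ^ (-k) * (1 + q ^ (2 k))`. The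
denominator cancels and the pentagonal series remains. -/
theorem evenAppellSum_neg_one_add {q : ℂ} (hq0 : q ≠ 0) (hq : ‖q‖ < 1) :
    evenAppellSum (-1) q + oddAppellSum (-1) q = qPochInf q q := by
  have hne : ∀ k : ℤ, Complex.I ^ 2 * q ^ (2 * k) ≠ 1 := fun k => by
    rw [Complex.I_sq]
    exact unit_mul_zpow_ne_one' (by simp) (by norm_num) hq _
  have hb := hasSum_oddAppellSum Complex.I_ne_zero hq0 hq hne
  have hb' := hb.tsum_eq
  rw [← oddAppellSum] at hb'
  rw [← hb', Complex.I_sq] at hb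
  have ha := (Equiv.neg ℤ).hasSum_iff.2
    (summable_evenAppellSum (X := -1) (by norm_num) hq0 hq).hasSum
  refine (ha.add hb).unique ((hasSum_pentagonal hq0 hq).of_eq (fun k => ?_) rfl)
  simp only [Function.comp_apply, Equiv.neg_apply]
  have h1 := sub_ne_zero.2 (hne k).symm
  rw [Complex.I_sq] at h1
  have e2 : ∀ m : ℤ, q ^ (2 * m) = (q ^ m) ^ 2 := fun m => by rw [zpow_mul', zpow_ofNat]
  have e3 : q ^ (-3 * k) = ((q ^ k) ^ 3)⁻¹ := by
    rw [neg_mul, zpow_neg, zpow_mul', zpow_ofNat]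
  have hk : q ^ k ≠ 0 := zpow_ne_zero k hq0
  rw [cubicWeight_neg hq0, e2, e2, e3, zpow_neg]
  rw [e2] at h1
  generalize q ^ k = y at *
  have h2 : y ^ 2 + 1 ≠ 0 := fun h => h1 (by linear_combination h)
  rw [show 1 - -1 * (y⁻¹) ^ 2 = (y ^ 2 + 1) / y ^ 2 by field_simp; ring,
    show 1 - -1 * y ^ 2 = y ^ 2 + 1 by ring]
  field_simp
  ring

theorem appellSum_I {q : ℂ} (hq0 : q ≠ 0) (hq : ‖q‖ < 1) :
    appellSum Complex.I q
      = (1 - Complex.I) * evenAppellSum (-1) q + Complex.I * qPochInf q q := by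
  rw [appellSum_eq_even_add_odd Complex.I_ne_zero hq0 hq fun k => by
    rw [Complex.I_sq]
    exact unit_mul_zpow_ne_one' (by simp) (by norm_num) hq _, Complex.I_sq]
  linear_combination Complex.I * evenAppellSum_neg_one_add hq0 hq

/-- Shift `k` by one and put `t = I * q ^ 3 * q ^ (2 k)`. The numerator is the cubic weight times `t
^ 2 / q ^ 2`, and `t ^ 2 / (1 - t) = 1 / (1 - t) - 1 - t`: the three pieces are an even Appell sum,
zero, and a shifted pentagonal series. -/
theorem oddAppellSum_I_mul {q : ℂ} (hq0 : q ≠ 0) (hq : ‖q‖ < 1) :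
    oddAppellSum (Complex.I * q) q
      = (Complex.I * q * qPochInf q q + evenAppellSum (Complex.I * q ^ 3) q) / q ^ 2 := by
  have h0 : ∑' k : ℤ, cubicWeight q k = 0 := tsum_eq_zero_of_reflect (cubicWeight_reflect q)
  have h1 := (summable_norm_cubicWeight hq0 hq).of_norm.hasSum
  rw [h0] at h1
  have h2 := (Equiv.addRight (1 : ℤ)).hasSum_iff.2 (hasSum_pentagonal hq0 hq)
  have h3 := (summable_evenAppellSum (X := Complex.I * q ^ 3)
    (mul_ne_zero Complex.I_ne_zero (pow_ne_zero 3 hq0)) hq0 hq).hasSum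
  have h4 := (((h2.mul_left (Complex.I * q)).add h3).sub h1).div_const (q ^ 2)
  rw [sub_zero] at h4
  rw [oddAppellSum, ← (Equiv.addRight (1 : ℤ)).tsum_eq]
  refine (h4.of_eq (fun k => ?_) rfl).tsum_eq
  simp only [Function.comp_apply, Equiv.coe_addRight]
  have hk : q ^ k ≠ 0 := zpow_ne_zero k hq0
  have e2 : ∀ m : ℤ, q ^ (2 * m) = (q ^ m) ^ 2 := fun m => by rw [zpow_mul', zpow_ofNat]
  have e3 : q ^ (3 * (k + 1)) = (q ^ k * q) ^ 3 := by
    rw [zpow_mul', zpow_add_one₀ hq0, zpow_ofNat]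
  have hd : 1 - Complex.I * q ^ 3 * (q ^ k) ^ 2 ≠ 0 := by
    rw [← e2, ← zpow_natCast, mul_assoc, ← zpow_add₀ hq0]
    exact sub_ne_zero.2 (unit_mul_zpow_ne_one (by simp) hq (by push_cast; omega)).symm
  rw [cubicWeight_add_one hq0, e2, e2, zpow_neg, e3, zpow_add_one₀ hq0]
  rw [show 1 - Complex.I * q * (q ^ k * q) ^ 2 = 1 - Complex.I * q ^ 3 * (q ^ k) ^ 2 by ring]
  generalize q ^ k = y at *
  have hI : Complex.I * q * (-cubicWeight q k * (y * q) ^ 3 * (y * q)⁻¹)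
      = -cubicWeight q k * (Complex.I * q ^ 3 * y ^ 2) := by field_simp
  have ht : (Complex.I * q ^ 3 * y ^ 2) ^ 2 = -(q ^ 6 * y ^ 4) := by
    linear_combination (q ^ 6 * y ^ 4) * Complex.I_sq
  rw [hI]
  generalize Complex.I * q ^ 3 * y ^ 2 = t at *
  field_simp
  linear_combination (-cubicWeight q k) * ht

/-- The choice `X = -q` makes the theta value in the numerator of `evenAppellSum_div` cancel one in
the denominator. -/
theorem evenAppellSum_neg_self_div {q : ℂ} (hq0 : q ≠ 0) (hq : ‖q‖ < 1) :
    evenAppellSum (-q) q / qPochInf q q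
      = qPochInf (q ^ 4) (q ^ 4) ^ 3 / qPochInf (q ^ 2) (q ^ 2) ^ 2
        - q * mockG (q ^ 2) (q ^ 4) := by
  have hX : ∀ k : ℤ, -q * (q ^ 2) ^ k ≠ 1 := fun k => by
    rw [← zpow_two_mul', neg_mul, ← zpow_one_add₀ hq0]
    exact neg_mul_zpow_ne_one hq (by omega)
  have hY : ∀ k : ℤ, q ^ 2 * (q ^ 4) ^ k ≠ 1 := fun k => by
    rw [← zpow_four_mul', ← zpow_natCast, ← zpow_add₀ hq0]
    exact zpow_ne_one_of_norm_lt_one hq (by push_cast; omega)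
  have h := evenAppellSum_div (neg_ne_zero.2 hq0) hq0 hq hX
    (by rw [mul_neg, neg_neg, ← pow_two]; exact hY)
  rw [mul_neg, neg_neg, ← pow_two] at h
  rw [h, mockG_eq_appellSum (pow_ne_zero 2 hq0) (pow_ne_zero 4 hq0)
    (norm_pow_lt_one hq four_ne_zero) hY, theta_sq_fourth hq0 hq]
  have ht := theta_ne_zero (neg_ne_zero.2 hq0) (pow_ne_zero 2 hq0)
    (norm_pow_lt_one hq two_ne_zero) hX
  have h2 := qPochInf_self_ne_zero (norm_pow_lt_one hq two_ne_zero)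
  have h4 := qPochInf_self_ne_zero (norm_pow_lt_one hq four_ne_zero)
  congr 1
  field_simp

theorem evenAppellSum_neg_one_div {q : ℂ} (hq0 : q ≠ 0) (hq : ‖q‖ < 1) :
    evenAppellSum (-1) q / qPochInf q q
      = qPochInf (q ^ 2) (q ^ 2) ^ 7 / (2 * qPochInf q q ^ 3 * qPochInf (q ^ 4) (q ^ 4) ^ 3)
        - q * mockG q (q ^ 4) := by
  have hq2 := norm_pow_lt_one hq two_ne_zero
  have hY : ∀ k : ℤ, q * (q ^ 4) ^ k ≠ 1 := fun k => by
    rw [← zpow_four_mul', ← zpow_one_add₀ hq0]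
    exact zpow_ne_one_of_norm_lt_one hq (by omega)
  have h := evenAppellSum_div (X := -1) (by norm_num) hq0 hq
    (unit_mul_zpow_ne_one' (by simp) (by norm_num) hq2)
    (by rw [mul_neg, neg_neg, mul_one]; exact hY)
  rw [mul_neg, neg_neg, mul_one] at h
  rw [h, mockG_eq_appellSum hq0 (pow_ne_zero 4 hq0)
    (norm_pow_lt_one hq four_ne_zero) hY, theta_neg_sq hq0 hq, theta_fourth hq0 hq,
    theta_neg_one hq2, ← pow_mul]
  have h1 := qPochInf_self_ne_zero hq
  have h2 := qPochInf_self_ne_zero hq2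
  have h4 := qPochInf_self_ne_zero (norm_pow_lt_one hq four_ne_zero)
  congr 1
  field_simp

theorem I_mul_zpow_ne_one {q : ℂ} (hq : ‖q‖ < 1) (n : ℤ) : Complex.I * q ^ n ≠ 1 := by
  refine unit_mul_zpow_ne_one' (by simp) (fun h => ?_) hq n
  have := congrArg Complex.re h
  simp at this

theorem neg_I_mul_zpow_ne_one {q : ℂ} (hq : ‖q‖ < 1) (n : ℤ) : -Complex.I * q ^ n ≠ 1 := by
  refine unit_mul_zpow_ne_one' (by simp) (fun h => ?_) hq n
  have := congrArg Complex.re h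
  simp at this

/-- The square of the argument is `-q ^ 4`, minus the base, so the odd part vanishes by
antisymmetry. -/
theorem appellSum_neg_I_mul_sq_div {q : ℂ} (hq0 : q ≠ 0) (hq : ‖q‖ < 1) :
    appellSum (-(Complex.I * q ^ 2)) (q ^ 4) / qPochInf (q ^ 4) (q ^ 4)
      = qPochInf (q ^ 16) (q ^ 16) ^ 3 / qPochInf (q ^ 8) (q ^ 8) ^ 2
        - q ^ 4 * mockG (q ^ 8) (q ^ 16) := by
  have hq4 := norm_pow_lt_one hq four_ne_zero
  have hsq : (-(Complex.I * q ^ 2)) ^ 2 = -q ^ 4 := by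
    linear_combination (q ^ 4) * Complex.I_sq
  have h := evenAppellSum_neg_self_div (pow_ne_zero 4 hq0) hq4
  simp only [← pow_mul] at h
  norm_num at h
  rw [appellSum_eq_even_add_odd (neg_ne_zero.2 (mul_ne_zero Complex.I_ne_zero (pow_ne_zero 2 hq0)))
    (pow_ne_zero 4 hq0) hq4 fun k => ?_, hsq, oddAppellSum_neg_self (pow_ne_zero 4 hq0) hq4,
    mul_zero, add_zero, h]
  rw [hsq, neg_mul, ← zpow_one_add₀ (pow_ne_zero 4 hq0)]
  exact neg_mul_zpow_ne_one hq4 (by omega)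

theorem theta_neg_sq_dissection_div {q : ℂ} (hq0 : q ≠ 0) (hq : ‖q‖ < 1) :
    theta (-q) (q ^ 2) = qPochInf (q ^ 8) (q ^ 8) ^ 5 /
        (qPochInf (q ^ 4) (q ^ 4) ^ 2 * qPochInf (q ^ 16) (q ^ 16) ^ 2)
      + q * (2 * qPochInf (q ^ 16) (q ^ 16) ^ 2 / qPochInf (q ^ 8) (q ^ 8)) := by
  have h1 := theta_neg_sq (pow_ne_zero 4 hq0) (norm_pow_lt_one hq four_ne_zero)
  have h2 := theta_neg_one (norm_pow_lt_one hq (n := 8) (by norm_num))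
  simp only [← pow_mul] at h1 h2
  norm_num at h1 h2
  rw [theta_neg_sq_dissection hq0 hq, h1, h2]

theorem evenAppellSum_I_mul_div {q : ℂ} (hq0 : q ≠ 0) (hq : ‖q‖ < 1) :
    evenAppellSum (Complex.I * q) q / qPochInf q q
      = qPochInf (q ^ 8) (q ^ 8) ^ 4 / (qPochInf (q ^ 4) (q ^ 4) ^ 2 * qPochInf (q ^ 16) (q ^ 16))
        + q * (qPochInf (q ^ 16) (q ^ 16) ^ 3 / qPochInf (q ^ 8) (q ^ 8) ^ 2
          + q ^ 4 * mockG (q ^ 8) (q ^ 16)) := by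
  have e : -(q * (Complex.I * q)) = -(Complex.I * q ^ 2) := by ring
  have h := evenAppellSum_div (mul_ne_zero Complex.I_ne_zero hq0) hq0 hq (fun k => by
      rw [← zpow_two_mul', mul_assoc, ← zpow_one_add₀ hq0]
      exact I_mul_zpow_ne_one hq _) (fun k => by
      rw [e, ← zpow_four_mul', ← neg_mul, mul_assoc, ← zpow_natCast, ← zpow_add₀ hq0]
      exact neg_I_mul_zpow_ne_one hq _)
  have h4 := qPochInf_self_ne_zero (norm_pow_lt_one hq four_ne_zero)
  have h8 := qPochInf_self_ne_zero (norm_pow_lt_one hq (n := 8) (by norm_num))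
  have h16 := qPochInf_self_ne_zero (norm_pow_lt_one hq (n := 16) (by norm_num))
  rw [e, appellSum_neg_I_mul_sq_div hq0 hq, theta_I_mul hq0 hq, theta_neg_I_mul_sq hq0 hq,
    theta_neg_sq_dissection_div hq0 hq] at h
  rw [h]
  field_simp
  ring

/-- `evenAppellSum_div` leads to the argument `q ^ 4 / I` in base `q ^ 4`, hence by symmetry to
`appellSum_I`. The first part of the two-dissection of `θ(-q; q²)` cancels the eta quotient coming
from `evenAppellSum_neg_one_div`. -/
theorem evenAppellSum_I_mul_cube_div {q : ℂ} (hq0 : q ≠ 0) (hq : ‖q‖ < 1) :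
    evenAppellSum (Complex.I * q ^ 3) q / qPochInf q q
      = -(Complex.I * q) + q * (1 - Complex.I) *
        (q * (qPochInf (q ^ 8) (q ^ 8) * qPochInf (q ^ 16) (q ^ 16) / qPochInf (q ^ 4) (q ^ 4))
          + q ^ 4 * mockG (q ^ 4) (q ^ 16)) := by
  have hq4 := norm_pow_lt_one hq four_ne_zero
  have hq40 := pow_ne_zero 4 hq0
  have e : -(q * (Complex.I * q ^ 3)) = -Complex.I * q ^ 4 := by ring
  have h := evenAppellSum_div (mul_ne_zero Complex.I_ne_zero (pow_ne_zero 3 hq0)) hq0 hq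
    (fun k => by
      rw [← zpow_two_mul', mul_assoc, ← zpow_natCast, ← zpow_add₀ hq0]
      exact I_mul_zpow_ne_one hq _) (fun k => by
      rw [e, ← zpow_four_mul', mul_assoc, ← zpow_natCast, ← zpow_add₀ hq0]
      exact neg_I_mul_zpow_ne_one hq _)
  have h4 := qPochInf_self_ne_zero hq4
  have h8 := qPochInf_self_ne_zero (norm_pow_lt_one hq (n := 8) (by norm_num))
  have h16 := qPochInf_self_ne_zero (norm_pow_lt_one hq (n := 16) (by norm_num))
  have hI := Complex.I_ne_zero
  have ht1 : theta (Complex.I * q ^ 3) (q ^ 2)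
      = Complex.I / q * (qPochInf (q ^ 4) (q ^ 4) ^ 2 / qPochInf (q ^ 8) (q ^ 8)) := by
    rw [← theta_I_mul hq0 hq, show Complex.I * q ^ 3 = Complex.I * q * q ^ 2 by ring,
      theta_mul (mul_ne_zero hI hq0) (pow_ne_zero 2 hq0) (norm_pow_lt_one hq two_ne_zero),
      mul_inv, Complex.inv_I]
    ring
  have ht2 : theta (-Complex.I * q ^ 4) (q ^ 4)
      = -Complex.I * ((1 + Complex.I) * qPochInf (q ^ 16) (q ^ 16) * qPochInf (q ^ 4) (q ^ 4)
        / qPochInf (q ^ 8) (q ^ 8)) := by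
    have := theta_neg_I hq4
    simp only [← pow_mul] at this
    norm_num at this
    rw [theta_mul (neg_ne_zero.2 hI) hq40 hq4, this, inv_neg, Complex.inv_I]
    ring
  have hL : appellSum (-Complex.I * q ^ 4) (q ^ 4) / qPochInf (q ^ 4) (q ^ 4)
      = (1 - Complex.I) * (qPochInf (q ^ 8) (q ^ 8) ^ 7 /
          (2 * qPochInf (q ^ 4) (q ^ 4) ^ 3 * qPochInf (q ^ 16) (q ^ 16) ^ 3)
        - q ^ 4 * mockG (q ^ 4) (q ^ 16)) + Complex.I := by
    have ha := evenAppellSum_neg_one_div hq40 hq4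
    simp only [← pow_mul] at ha
    norm_num at ha
    rw [show -Complex.I * q ^ 4 = q ^ 4 / Complex.I by rw [Complex.div_I]; ring,
      appellSum_div hI hq40 hq4 (I_mul_zpow_ne_one hq4), appellSum_I hq40 hq4, ← ha]
    field_simp
  have hI1 : (1 + Complex.I) ≠ 0 := fun h => by simpa using congrArg Complex.re h
  have hI2 : 1 / (1 + Complex.I) = (1 - Complex.I) / 2 := by
    rw [div_eq_div_iff hI1 two_ne_zero]
    linear_combination Complex.I_sq
  rw [e, hL, ht1, ht2, theta_neg_sq_dissection_div hq0 hq] at h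
  have hden : Complex.I / q * (qPochInf (q ^ 4) (q ^ 4) ^ 2 / qPochInf (q ^ 8) (q ^ 8)) *
      (-Complex.I * ((1 + Complex.I) * qPochInf (q ^ 16) (q ^ 16) * qPochInf (q ^ 4) (q ^ 4)
        / qPochInf (q ^ 8) (q ^ 8)))
      = (1 + Complex.I) * (qPochInf (q ^ 4) (q ^ 4) ^ 3 * qPochInf (q ^ 16) (q ^ 16) /
        (q * qPochInf (q ^ 8) (q ^ 8) ^ 2)) := by
    field_simp
    rw [Complex.I_sq]
    ring
  rw [hden, ← div_div, div_eq_mul_one_div _ (1 + Complex.I), hI2] at h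
  rw [h]
  field_simp
  ring

theorem oddAppellSum_I_mul_div {q : ℂ} (hq0 : q ≠ 0) (hq : ‖q‖ < 1) :
    oddAppellSum (Complex.I * q) q / qPochInf q q
      = (1 - Complex.I) / q *
        (q * (qPochInf (q ^ 8) (q ^ 8) * qPochInf (q ^ 16) (q ^ 16) / qPochInf (q ^ 4) (q ^ 4))
          + q ^ 4 * mockG (q ^ 4) (q ^ 16)) := by
  have h := evenAppellSum_I_mul_cube_div hq0 hq
  have h1 := qPochInf_self_ne_zero hq
  have h4 := qPochInf_self_ne_zero (norm_pow_lt_one hq four_ne_zero)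
  rw [div_eq_iff h1] at h
  rw [oddAppellSum_I_mul hq0 hq, h]
  field_simp
  ring

/-- The eight-dissection of the odd rank generating function at a primitive eighth root of
unity. -/
theorem mul_appellSum_eighth_root {z w : ℂ} (hz : z ^ 2 = Complex.I) (hw0 : w ≠ 0)
    (hw : ‖w‖ < 1) :
    w * (appellSum (z * w) (w ^ 2) / qPochInf (w ^ 2) (w ^ 2))
      = w * (eulerJ 2 (w ^ 8) ^ 4 / (eulerJ 1 (w ^ 8) ^ 2 * eulerJ 4 (w ^ 8)))
        + w ^ 3 * (eulerJ 4 (w ^ 8) ^ 3 / eulerJ 2 (w ^ 8) ^ 2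
          + w ^ 8 * mockG ((w ^ 8) ^ 2) ((w ^ 8) ^ 4))
        + z * (1 - Complex.I) * (w ^ 8 * mockG (w ^ 8) ((w ^ 8) ^ 4)
          + w ^ 2 * (eulerJ 2 (w ^ 8) * eulerJ 4 (w ^ 8) / eulerJ 1 (w ^ 8))) := by
  have hp0 := pow_ne_zero 2 hw0
  have hp := norm_pow_lt_one hw two_ne_zero
  have hz0 : z ≠ 0 := fun h => Complex.I_ne_zero (by rw [← hz, h]; ring)
  have hsq : (z * w) ^ 2 = Complex.I * w ^ 2 := by rw [mul_pow, hz]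
  have h := appellSum_eq_even_add_odd (mul_ne_zero hz0 hw0) hp0 hp fun k => by
    rw [hsq, mul_assoc, ← zpow_one_add₀ hp0]
    exact I_mul_zpow_ne_one hp _
  have he := evenAppellSum_I_mul_div hp0 hp
  have ho := oddAppellSum_I_mul_div hp0 hp
  rw [h, hsq, add_div, he, mul_div_assoc, ho]
  simp only [eulerJ, ← pow_mul]
  norm_num
  field_simp
  ring

/-! ### Generating functions of rows and of odd Durfee symbols. -/

/-- Nonincreasing lists of odd numbers less than `2 m`. -/
def OddRow (m : ℕ) : Type :=
  {l : List ℕ // l.Pairwise (fun a b => a ≥ b) ∧ ∀ a ∈ l, Odd a ∧ a < 2 * m}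

theorem pairwise_replicate_append {m k : ℕ} (l : OddRow m) :
    (List.replicate k (2 * m + 1) ++ l.1).Pairwise (fun a b => a ≥ b) := by
  rw [List.pairwise_append]
  refine ⟨List.pairwise_replicate.2 (Or.inr le_rfl), l.2.1, fun a ha b hb => ?_⟩
  have h1 := List.eq_of_mem_replicate ha
  have h2 := (l.2.2 b hb).2
  omega

theorem not_mem_oddRow {m : ℕ} (l : OddRow m) : 2 * m + 1 ∉ l.1 := fun h => by
  have := (l.2.2 _ h).2
  omega

/-- Adjoin `k` copies of the part `2 m + 1` to a row with smaller parts. -/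
def OddRow.adjoin (m : ℕ) (p : ℕ × OddRow m) : OddRow (m + 1) :=
  ⟨List.replicate p.1 (2 * m + 1) ++ p.2.1, pairwise_replicate_append p.2, fun a ha => by
    rcases List.mem_append.1 ha with h | h
    · rw [List.eq_of_mem_replicate h]
      exact ⟨⟨m, rfl⟩, by omega⟩
    · have := p.2.2.2 a h
      exact ⟨this.1, by omega⟩⟩

theorem OddRow.adjoin_bijective (m : ℕ) : Function.Bijective (OddRow.adjoin m) := by
  constructor
  · rintro ⟨k, l⟩ ⟨k', l'⟩ h
    have h1 : List.replicate k (2 * m + 1) ++ l.1 = List.replicate k' (2 * m + 1) ++ l'.1 :=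
      congrArg Subtype.val h
    have h2 := congrArg (List.count (2 * m + 1)) h1
    simp only [List.count_append, List.count_replicate_self,
      List.count_eq_zero.2 (not_mem_oddRow _), add_zero] at h2
    subst h2
    rw [Prod.mk.injEq]
    exact ⟨rfl, Subtype.ext (List.append_cancel_left h1)⟩
  · rintro ⟨l, hl⟩
    induction l with
    | nil => exact ⟨(0, ⟨[], by simp⟩), rfl⟩
    | cons a t ih =>
      have ha := hl.2 a List.mem_cons_self
      by_cases h : a = 2 * m + 1
      · obtain ⟨⟨k, l⟩, hkl⟩ := ih ⟨hl.1.of_cons, fun b hb => hl.2 b (List.mem_cons_of_mem _ hb)⟩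
        refine ⟨(k + 1, l), Subtype.ext ?_⟩
        have := congrArg Subtype.val hkl
        simp only [OddRow.adjoin] at this ⊢
        rw [List.replicate_succ, List.cons_append, this, h]
      · refine ⟨(0, ⟨a :: t, hl.1, fun b hb => ⟨(hl.2 b hb).1, ?_⟩⟩), rfl⟩
        obtain ⟨c, hc⟩ := ha.1
        rcases List.mem_cons.1 hb with rfl | hb
        · omega
        · have := List.rel_of_pairwise_cons hl.1 hb
          omega

theorem hasSum_oddRow {y w : ℂ} (hy : ‖y‖ = 1) (hw : ‖w‖ < 1) (m : ℕ) :
    HasSum (fun l : OddRow m => y ^ l.1.length * w ^ l.1.sum) (qPoch (y * w) (w ^ 2) m)⁻¹ := by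
  induction m with
  | zero =>
    let _ : Unique (OddRow 0) := ⟨⟨⟨[], by simp⟩⟩, fun l => Subtype.ext <|
      List.eq_nil_iff_forall_not_mem.2 fun a ha => by have := (l.2.2 a ha).2; omega⟩
    refine (hasSum_unique _).of_eq (fun _ => rfl) ?_
    rw [qPoch_zero, inv_one]
    exact (by simp : (1 : ℂ) = y ^ ([] : List ℕ).length * w ^ ([] : List ℕ).sum)
  | succ m ih =>
    have hg : ‖y * w ^ (2 * m + 1)‖ < 1 := by
      rw [norm_mul, hy, one_mul, norm_pow]
      exact pow_lt_one₀ (norm_nonneg w) hw (by omega)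
    have h := hasSum_product (hasSum_geometric_of_norm_lt_one hg) ih
    rw [← (Equiv.ofBijective _ (OddRow.adjoin_bijective m)).hasSum_iff]
    refine h.of_eq (fun p => ?_) ?_
    · simp only [Function.comp_apply, Equiv.ofBijective_apply, OddRow.adjoin, List.length_append,
        List.length_replicate, List.sum_append, List.sum_replicate, smul_eq_mul]
      rw [mul_pow, ← pow_mul, pow_add, pow_add]
      ring
    · rw [qPoch_succ, mul_inv, mul_comm]
      congr 3
      ring

/-- The generating function weight `z ^ rank w ^ n` of a triple of two rows and a subscript. -/
noncomputable def durfeeWeight (z w : ℂ) (s : Σ D : ℕ, OddRow (D + 1) × OddRow (D + 1)) : ℂ :=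
  w ^ (2 * s.1 ^ 2 + 2 * s.1 + 1) *
    ((z ^ s.2.1.1.length * w ^ s.2.1.1.sum) * (z⁻¹ ^ s.2.2.1.length * w ^ s.2.2.1.sum))

theorem hasSum_durfeeWeight_fiber {z w : ℂ} (hz : ‖z‖ = 1) (hw0 : w ≠ 0) (hw : ‖w‖ < 1) (D : ℕ) :
    HasSum (fun p => durfeeWeight z w ⟨D, p⟩)
      (w * ((w ^ 2) ^ (D ^ 2 + D) /
        (qPoch (z * w) (w ^ 2) (D + 1) * qPoch (w ^ 2 / (z * w)) (w ^ 2) (D + 1)))) := by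
  have hz0 : z ≠ 0 := fun h => by simp [h] at hz
  have h := (hasSum_product (hasSum_oddRow hz hw (D + 1))
    (hasSum_oddRow (y := z⁻¹) (by rw [norm_inv, hz, inv_one]) hw (D + 1))).mul_left
      (w ^ (2 * D ^ 2 + 2 * D + 1))
  refine h.of_eq (fun p => rfl) ?_
  rw [show w ^ 2 / (z * w) = z⁻¹ * w by field_simp, div_eq_mul_inv, mul_inv]
  ring

theorem rank_points_ne_one {z w : ℂ} (hz : ‖z‖ = 1) (hw0 : w ≠ 0) (hw : ‖w‖ < 1) (k : ℤ) :
    z * w * (w ^ 2) ^ k ≠ 1 := by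
  rw [← zpow_two_mul', mul_assoc, ← zpow_one_add₀ hw0]
  exact unit_mul_zpow_ne_one hz hw (by omega)

/-- The norms of the weights are themselves weights, at `z = 1` and `‖w‖`, so the exact fibre sums
already known also prove absolute convergence. -/
theorem summable_durfeeWeight {z w : ℂ} (hz : ‖z‖ = 1) (hw0 : w ≠ 0) (hw : ‖w‖ < 1) :
    Summable (durfeeWeight z w) := by
  have hr0 : (‖w‖ : ℂ) ≠ 0 := by simpa using hw0
  have hr : ‖(‖w‖ : ℂ)‖ < 1 := by simpa using hw
  have hn : ∀ s, (‖durfeeWeight z w s‖ : ℂ) = durfeeWeight 1 ‖w‖ s := fun s => by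
    simp [durfeeWeight, hz]
  have hfib := fun D => hasSum_durfeeWeight_fiber (z := 1) (by simp) hr0 hr D
  have hfib' : ∀ D, HasSum (fun p => ((‖durfeeWeight z w ⟨D, p⟩‖ : ℝ) : ℂ)) _ := fun D =>
    (hfib D).of_eq (fun p => hn _) rfl
  refine Summable.of_norm ((summable_sigma_of_nonneg fun _ => norm_nonneg _).2
    ⟨fun D => Complex.summable_ofReal.1 (hfib' D).summable, Complex.summable_ofReal.1 ?_⟩)
  have h := (hasSum_appellSum (mul_ne_zero one_ne_zero hr0) (pow_ne_zero 2 hr0)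
    (norm_pow_lt_one hr two_ne_zero) (rank_points_ne_one (by simp) hr0 hr)).summable.mul_left
      (‖w‖ : ℂ)
  refine h.congr fun D => ?_
  rw [Complex.ofReal_tsum, (hfib' D).tsum_eq]

theorem hasSum_durfeeWeight {z w : ℂ} (hz : ‖z‖ = 1) (hw0 : w ≠ 0) (hw : ‖w‖ < 1) :
    HasSum (durfeeWeight z w)
      (w * (appellSum (z * w) (w ^ 2) / qPochInf (w ^ 2) (w ^ 2))) := by
  have hz0 : z ≠ 0 := fun h => by simp [h] at hz
  exact ((hasSum_appellSum (mul_ne_zero hz0 hw0) (pow_ne_zero 2 hw0)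
    (norm_pow_lt_one hw two_ne_zero) (rank_points_ne_one hz hw0 hw)).mul_left w).sigma_of_hasSum
      (hasSum_durfeeWeight_fiber hz hw0 hw) (summable_durfeeWeight hz hw0 hw)

/-- Odd Durfee symbols of all integers, as triples of a subscript and two rows. -/
def oddDurfeeSymbolEquiv :
    (Σ n : ℕ, OddDurfeeSymbol n) ≃ Σ D : ℕ, OddRow (D + 1) × OddRow (D + 1) where
  toFun s := ⟨s.2.D, ⟨s.2.top, s.2.top_pairwise, fun a ha =>
      ⟨(s.2.top_mem a ha).1, by have := (s.2.top_mem a ha).2; omega⟩⟩,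
    ⟨s.2.bot, s.2.bot_pairwise, fun a ha =>
      ⟨(s.2.bot_mem a ha).1, by have := (s.2.bot_mem a ha).2; omega⟩⟩⟩
  invFun t := ⟨t.2.1.1.sum + t.2.2.1.sum + (2 * t.1 ^ 2 + 2 * t.1 + 1),
    { top := t.2.1.1
      bot := t.2.2.1
      D := t.1
      top_pairwise := t.2.1.2.1
      bot_pairwise := t.2.2.2.1
      top_mem := fun a ha => ⟨(t.2.1.2.2 a ha).1, by have := (t.2.1.2.2 a ha).2; omega⟩
      bot_mem := fun a ha => ⟨(t.2.2.2.2 a ha).1, by have := (t.2.2.2.2 a ha).2; omega⟩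
      sum_eq := rfl }⟩
  left_inv := by
    rintro ⟨n, s⟩
    obtain ⟨top, bot, D, h1, h2, h3, h4, h5⟩ := s
    subst h5
    rfl
  right_inv _ := rfl

/-- The generating function of odd Durfee symbols by odd rank. -/
theorem hasSum_oddRank {z w : ℂ} (hz : ‖z‖ = 1) (hw0 : w ≠ 0) (hw : ‖w‖ < 1) :
    HasSum (fun n : ℕ => (∑' s : OddDurfeeSymbol n, z ^ s.oddRank) * w ^ n)
      (w * (appellSum (z * w) (w ^ 2) / qPochInf (w ^ 2) (w ^ 2))) := by
  have hz0 : z ≠ 0 := fun h => by simp [h] at hz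
  have h := oddDurfeeSymbolEquiv.hasSum_iff.2 (hasSum_durfeeWeight hz hw0 hw)
  refine h.sigma fun n => ?_
  have := Fintype.ofFinite (OddDurfeeSymbol n)
  refine (((hasSum_fintype _).summable.hasSum (f := fun s : OddDurfeeSymbol n =>
    z ^ s.oddRank)).mul_right (w ^ n)).of_eq (fun s => ?_) rfl
  change w ^ (2 * s.D ^ 2 + 2 * s.D + 1) * ((z ^ s.top.length * w ^ s.top.sum) *
    (z⁻¹ ^ s.bot.length * w ^ s.bot.sum)) = z ^ s.oddRank * w ^ n
  have hn : w ^ n = w ^ (s.top.sum + s.bot.sum + (2 * s.D ^ 2 + 2 * s.D + 1)) := by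
    rw [s.sum_eq]
  rw [hn, OddDurfeeSymbol.oddRank, zpow_sub₀ hz0, zpow_natCast, zpow_natCast, pow_add w,
    pow_add w, inv_pow]
  ring

/-! ### Symmetry, parity, and the rank modulo 8. -/

/-- Interchange of the two rows of an odd Durfee symbol. -/
def OddDurfeeSymbol.swap {n : ℕ} (s : OddDurfeeSymbol n) : OddDurfeeSymbol n where
  top := s.bot
  bot := s.top
  D := s.D
  top_pairwise := s.bot_pairwise
  bot_pairwise := s.top_pairwise
  top_mem := s.bot_mem
  bot_mem := s.top_mem
  sum_eq := by rw [add_comm s.bot.sum]; exact s.sum_eq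

theorem OddDurfeeSymbol.oddRank_swap {n : ℕ} (s : OddDurfeeSymbol n) :
    s.swap.oddRank = -s.oddRank := by
  simp [oddRank, swap]

theorem oddRankCount_neg (a : ℤ) (M n : ℕ) : oddRankCount (-a) M n = oddRankCount a M n := by
  let e : OddDurfeeSymbol n ≃ OddDurfeeSymbol n :=
    ⟨OddDurfeeSymbol.swap, OddDurfeeSymbol.swap, fun _ => rfl, fun _ => rfl⟩
  refine Nat.card_congr (e.subtypeEquiv fun s => ?_)
  change _ ↔ s.swap.oddRank ≡ a [ZMOD M]
  rw [OddDurfeeSymbol.oddRank_swap]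
  exact ⟨fun h => by simpa using h.neg, fun h => by simpa using h.neg⟩

theorem even_sum_add_length {l : List ℕ} (hl : ∀ a ∈ l, Odd a) : Even (l.sum + l.length) := by
  induction l with
  | nil => simp
  | cons a t ih =>
    have h1 := hl a List.mem_cons_self
    have h2 := ih fun b hb => hl b (List.mem_cons_of_mem _ hb)
    rw [List.sum_cons, List.length_cons, show a + t.sum + (t.length + 1)
      = (a + 1) + (t.sum + t.length) by ring]
    exact h1.add_one.add h2

/-- A sum of odd parts has the parity of their number, and `2 D ^ 2 + 2 D + 1` is odd. -/
theorem OddDurfeeSymbol.odd_oddRank_add {n : ℕ} (s : OddDurfeeSymbol n) :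
    Odd (s.oddRank + n) := by
  obtain ⟨c, hc⟩ := even_sum_add_length fun a ha => (s.top_mem a ha).1
  obtain ⟨d, hd⟩ := even_sum_add_length fun a ha => (s.bot_mem a ha).1
  have h := s.sum_eq
  refine ⟨c + d + s.D ^ 2 + s.D - s.bot.length, ?_⟩
  rw [oddRank]
  zify at h hc hd
  linarith

theorem oddRankCount_eq_zero {a : ℤ} {n : ℕ} (h : Even (a + n)) : oddRankCount a 8 n = 0 := by
  have : IsEmpty {s : OddDurfeeSymbol n // s.oddRank ≡ a [ZMOD (8 : ℕ)]} := by
    refine ⟨fun s => ?_⟩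
    obtain ⟨c, hc⟩ := s.1.odd_oddRank_add
    obtain ⟨d, hd⟩ := h
    have h1 := s.2
    rw [Int.ModEq] at h1
    push_cast at h1
    omega
  exact Nat.card_of_isEmpty

theorem hasSum_oddRankCount (a : ℤ) (n : ℕ) :
    HasSum (fun s : OddDurfeeSymbol n => if s.oddRank ≡ a [ZMOD (8 : ℕ)] then (1 : ℂ) else 0)
      (oddRankCount a 8 n) := by
  have := Fintype.ofFinite (OddDurfeeSymbol n)
  refine (hasSum_fintype _).of_eq (fun _ => rfl) ?_
  rw [oddRankCount, Finset.sum_boole, Nat.card_eq_fintype_card, Fintype.card_subtype]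

/-- Since `z ^ 4 = -1`, antipodal classes modulo 8 share a basis power. The representatives `-3, -2,
-1` are chosen for use with `oddRankCount_neg`. -/
theorem zpow_eighth_root {z : ℂ} (hz : z ^ 2 = Complex.I) (r : ℤ) :
    z ^ r = ((if r ≡ 0 [ZMOD (8 : ℕ)] then 1 else 0) - (if r ≡ 4 [ZMOD (8 : ℕ)] then 1 else 0))
      + z * ((if r ≡ 1 [ZMOD (8 : ℕ)] then 1 else 0) - (if r ≡ -3 [ZMOD (8 : ℕ)] then 1 else 0))
      + z ^ 2 * ((if r ≡ 2 [ZMOD (8 : ℕ)] then 1 else 0)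
        - (if r ≡ -2 [ZMOD (8 : ℕ)] then 1 else 0))
      + z ^ 3 * ((if r ≡ 3 [ZMOD (8 : ℕ)] then 1 else 0)
        - (if r ≡ -1 [ZMOD (8 : ℕ)] then 1 else 0)) := by
  have hz0 : z ≠ 0 := fun h => Complex.I_ne_zero (by rw [← hz, h]; ring)
  have h4 : z ^ 4 = -1 := by rw [show z ^ 4 = (z ^ 2) ^ 2 by ring, hz, Complex.I_sq]
  have h8 : z ^ (8 : ℤ) = 1 := by
    rw [show (8 : ℤ) = ((8 : ℕ) : ℤ) by rfl, zpow_natCast, show z ^ 8 = (z ^ 4) ^ 2 by ring, h4]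
    ring
  have hr : z ^ r = z ^ (r % 8) := by
    conv_lhs => rw [← Int.emod_add_mul_ediv r 8, zpow_add₀ hz0, zpow_mul, h8, one_zpow, mul_one]
  obtain ⟨j, hj⟩ : ∃ j : ℕ, r % 8 = j := ⟨(r % 8).toNat, by omega⟩
  have hj8 : j < 8 := by omega
  have hm : ∀ a : ℤ, (r ≡ a [ZMOD (8 : ℕ)]) ↔ (j : ℤ) = a % 8 := fun a => by
    rw [Int.ModEq, ← hj]
    rfl
  simp only [hm]
  rw [hr, hj, zpow_natCast]
  clear hm hr hj
  interval_cases j <;> norm_num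
  · exact h4
  · linear_combination z * h4
  · linear_combination z ^ 2 * h4
  · linear_combination z ^ 3 * h4

theorem tsum_eighth_root_oddRank {z : ℂ} (hz : z ^ 2 = Complex.I) (n : ℕ) :
    ∑' s : OddDurfeeSymbol n, z ^ s.oddRank
      = ((oddRankCount 0 8 n : ℂ) - oddRankCount 4 8 n)
        + z * (1 - Complex.I) * ((oddRankCount 1 8 n : ℂ) - oddRankCount 3 8 n) := by
  have N := fun a => hasSum_oddRankCount a n
  have h := ((((N 0).sub (N 4)).add (((N 1).sub (N (-3))).mul_left z)).add
    (((N 2).sub (N (-2))).mul_left (z ^ 2))).add (((N 3).sub (N (-1))).mul_left (z ^ 3))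
  rw [(h.of_eq (fun s => zpow_eighth_root hz _) rfl).tsum_eq, oddRankCount_neg, oddRankCount_neg,
    oddRankCount_neg]
  -- By symmetry the coefficient of `z ^ 2` vanishes and that of `z ^ 3` is minus that of `z`;
  -- finally `z - z ^ 3 = z * (1 - I)`.
  linear_combination z * ((oddRankCount 3 8 n : ℂ) - oddRankCount 1 8 n) * hz

/-! ### Roots of unity filter. -/

theorem sum_primitiveRoot_pow {z : ℂ} {M : ℕ} (hz : IsPrimitiveRoot z M) (n : ℕ) :
    ∑ j ∈ Finset.range M, (z ^ n) ^ j = if M ∣ n then (M : ℂ) else 0 := by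
  split_ifs with h
  · rw [(hz.pow_eq_one_iff_dvd n).2 h]
    simp
  · have h1 : z ^ n ≠ 1 := fun h1 => h ((hz.pow_eq_one_iff_dvd n).1 h1)
    rw [geom_sum_eq h1, ← pow_mul, mul_comm, pow_mul, hz.pow_eq_one, one_pow, sub_self, zero_div]

/-- Extraction of a residue class of exponents from a dissected power series. -/
theorem hasSum_residue_class {z w : ℂ} {M : ℕ} (hz : IsPrimitiveRoot z M) (hM : 0 < M)
    (hw0 : w ≠ 0) {a c : ℕ → ℂ}
    (h : ∀ j, HasSum (fun n => a n * (z ^ j * w) ^ n)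
      (∑ s ∈ Finset.range M, c s * (z ^ j * w) ^ s)) {r : ℕ} (hr : r < M) :
    HasSum (fun m => a (M * m + r) * (w ^ M) ^ m) (c r) := by
  have hM0 : (M : ℂ) ≠ 0 := Nat.cast_ne_zero.2 hM.ne'
  have hdvd : ∀ n, M ∣ n + (M - r) ↔ n % M = r := by
    intro n
    rw [Nat.dvd_iff_mod_eq_zero, Nat.add_mod]
    have h1 := Nat.mod_lt n hM
    rcases Nat.eq_zero_or_pos r with rfl | hr0
    · simp
    · rw [Nat.mod_eq_of_lt (by omega : M - r < M)]
      constructor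
      · intro h2
        rcases lt_or_ge (n % M + (M - r)) M with h3 | h3
        · rw [Nat.mod_eq_of_lt h3] at h2; omega
        · rw [Nat.mod_eq_sub_mod h3, Nat.mod_eq_of_lt (by omega)] at h2; omega
      · intro h2
        rw [h2, show r + (M - r) = M by omega, Nat.mod_self]
  -- The exponent `M - r` stands for `-r`, which keeps all powers natural. The filter is applied
  -- both to the series and to the finite sum.
  have hfilter : ∀ n, ∑ j ∈ Finset.range M, (z ^ (M - r)) ^ j * (z ^ j * w) ^ n
      = if n % M = r then M * w ^ n else 0 := by
    intro n
    have := sum_primitiveRoot_pow hz (n + (M - r))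
    simp only [hdvd] at this
    have e : ∑ j ∈ Finset.range M, (z ^ (M - r)) ^ j * (z ^ j * w) ^ n
        = (∑ j ∈ Finset.range M, (z ^ (n + (M - r))) ^ j) * w ^ n := by
      rw [Finset.sum_mul]
      exact Finset.sum_congr rfl fun j _ => by rw [mul_pow, pow_add]; ring
    rw [e, this]
    split_ifs <;> simp
  have hs := (hasSum_sum fun j (_ : j ∈ Finset.range M) =>
    (h j).mul_left ((z ^ (M - r)) ^ j)).mul_left (M * w ^ r : ℂ)⁻¹
  have hs2 : HasSum (fun n => if n % M = r then a n * w ^ n / w ^ r else 0) (c r) := by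
    refine hs.of_eq (fun n => ?_) ?_
    · have := hfilter n
      rw [show ∑ j ∈ Finset.range M, (z ^ (M - r)) ^ j * (a n * (z ^ j * w) ^ n)
        = a n * ∑ j ∈ Finset.range M, (z ^ (M - r)) ^ j * (z ^ j * w) ^ n by
          rw [Finset.mul_sum]; exact Finset.sum_congr rfl fun j _ => by ring, this]
      split_ifs
      · field_simp
      · simp
    · simp only [Finset.mul_sum]
      rw [Finset.sum_comm, Finset.sum_eq_single_of_mem r (Finset.mem_range.2 hr)]
      · have := hfilter r
        rw [if_pos (Nat.mod_eq_of_lt hr)] at this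
        rw [← Finset.mul_sum, show ∑ j ∈ Finset.range M, (z ^ (M - r)) ^ j * (c r * (z ^ j * w) ^ r)
          = c r * ∑ j ∈ Finset.range M, (z ^ (M - r)) ^ j * (z ^ j * w) ^ r by
            rw [Finset.mul_sum]; exact Finset.sum_congr rfl fun j _ => by ring, this]
        field_simp
      · intro s hs hsr
        have := hfilter s
        rw [if_neg (by rwa [Nat.mod_eq_of_lt (Finset.mem_range.1 hs)])] at this
        rw [← Finset.mul_sum, show ∑ j ∈ Finset.range M, (z ^ (M - r)) ^ j * (c s * (z ^ j * w) ^ s)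
          = c s * ∑ j ∈ Finset.range M, (z ^ (M - r)) ^ j * (z ^ j * w) ^ s by
            rw [Finset.mul_sum]; exact Finset.sum_congr rfl fun j _ => by ring, this]
        simp
  have hinj : Function.Injective fun m : ℕ => M * m + r := fun a b hab => by
    have : M * a = M * b := by simpa using hab
    exact Nat.eq_of_mul_eq_mul_left hM this
  rw [← hinj.hasSum_iff] at hs2
  · refine hs2.of_eq (fun m => ?_) rfl
    rw [Function.comp_apply, if_pos (by rw [Nat.mul_add_mod, Nat.mod_eq_of_lt hr]), pow_add, pow_mul]
    field_simp
  · intro n hn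
    rw [if_neg]
    intro h1
    exact hn ⟨n / M, by simp only; rw [← h1]; exact Nat.div_add_mod n M⟩

/-! ### Symbols of 1 and 2, which give the constant terms needed at `q = 0`. -/

theorem eq_nil_of_sum_eq_zero {l : List ℕ} (hl : ∀ a ∈ l, Odd a) (h : l.sum = 0) : l = [] := by
  cases l with
  | nil => rfl
  | cons a t =>
    have := (hl a List.mem_cons_self).pos
    rw [List.sum_cons] at h
    omega

theorem eq_singleton_of_sum_eq_one {l : List ℕ} (hl : ∀ a ∈ l, Odd a) (h : l.sum = 1) :
    l = [1] := by
  cases l with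
  | nil => simp at h
  | cons a t =>
    have := (hl a List.mem_cons_self).pos
    rw [List.sum_cons] at h
    rw [eq_nil_of_sum_eq_zero (fun b hb => hl b (List.mem_cons_of_mem _ hb)) (by omega),
      show a = 1 by omega]

theorem oddDurfeeSymbol_one (s : OddDurfeeSymbol 1) : s.top = [] ∧ s.bot = [] ∧ s.D = 0 := by
  have h := s.sum_eq
  exact ⟨eq_nil_of_sum_eq_zero (fun a ha => (s.top_mem a ha).1) (by omega),
    eq_nil_of_sum_eq_zero (fun a ha => (s.bot_mem a ha).1) (by omega), by omega⟩

theorem oddDurfeeSymbol_two (s : OddDurfeeSymbol 2) :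
    s.D = 0 ∧ (s.top = [1] ∧ s.bot = [] ∨ s.top = [] ∧ s.bot = [1]) := by
  have h := s.sum_eq
  have ht := fun a ha => (s.top_mem a ha).1
  have hb := fun a ha => (s.bot_mem a ha).1
  have hD : s.D = 0 := by
    by_contra hD
    have : 1 ≤ s.D := Nat.one_le_iff_ne_zero.2 hD
    omega
  rw [hD] at h
  refine ⟨hD, ?_⟩
  rcases Nat.eq_zero_or_pos s.top.sum with h0 | h0
  · exact Or.inr ⟨eq_nil_of_sum_eq_zero ht h0, eq_singleton_of_sum_eq_one hb (by omega)⟩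
  · exact Or.inl ⟨eq_singleton_of_sum_eq_one ht (by omega), eq_nil_of_sum_eq_zero hb (by omega)⟩

theorem oddRankCount_zero_one : oddRankCount 0 8 1 = 1 := by
  refine Nat.card_eq_one_iff_unique.2 ⟨⟨fun s t => Subtype.ext ?_⟩,
    ⟨⟨⟨[], [], 0, by simp, by simp, by simp, by simp, by simp⟩, by simp [OddDurfeeSymbol.oddRank]⟩⟩⟩
  obtain ⟨h1, h2, h3⟩ := oddDurfeeSymbol_one s.1
  obtain ⟨h4, h5, h6⟩ := oddDurfeeSymbol_one t.1
  exact OddDurfeeSymbol.ext (h1.trans h4.symm) (h2.trans h5.symm) (h3.trans h6.symm)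

theorem oddRankCount_four_one : oddRankCount 4 8 1 = 0 := by
  have : IsEmpty {s : OddDurfeeSymbol 1 // s.oddRank ≡ 4 [ZMOD (8 : ℕ)]} := by
    refine ⟨fun s => ?_⟩
    obtain ⟨h1, h2, h3⟩ := oddDurfeeSymbol_one s.1
    have h := s.2
    simp [OddDurfeeSymbol.oddRank, h1, h2, Int.ModEq] at h
  exact Nat.card_of_isEmpty

theorem oddRankCount_one_two : oddRankCount 1 8 2 = 1 := by
  have key : ∀ s : {s : OddDurfeeSymbol 2 // s.oddRank ≡ 1 [ZMOD (8 : ℕ)]},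
      s.1.D = 0 ∧ s.1.top = [1] ∧ s.1.bot = [] := by
    intro s
    obtain ⟨h1, h2 | h2⟩ := oddDurfeeSymbol_two s.1
    · exact ⟨h1, h2⟩
    · have h := s.2
      simp [OddDurfeeSymbol.oddRank, h2, Int.ModEq] at h
  refine Nat.card_eq_one_iff_unique.2 ⟨⟨fun s t => Subtype.ext ?_⟩,
    ⟨⟨⟨[1], [], 0, by simp, by simp, by simp, by simp, by simp⟩, by simp [OddDurfeeSymbol.oddRank]⟩⟩⟩
  obtain ⟨h1, h2, h3⟩ := key s
  obtain ⟨h4, h5, h6⟩ := key t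
  exact OddDurfeeSymbol.ext (h2.trans h5.symm) (h3.trans h6.symm) (h1.trans h4.symm)

theorem oddRankCount_three_two : oddRankCount 3 8 2 = 0 := by
  have : IsEmpty {s : OddDurfeeSymbol 2 // s.oddRank ≡ 3 [ZMOD (8 : ℕ)]} := by
    refine ⟨fun s => ?_⟩
    have h := s.2
    obtain ⟨h1, h2 | h2⟩ := oddDurfeeSymbol_two s.1 <;>
      simp [OddDurfeeSymbol.oddRank, h2, Int.ModEq] at h
  exact Nat.card_of_isEmpty

theorem eulerJ_zero {m : ℕ} (hm : m ≠ 0) : eulerJ m 0 = 1 := by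
  simp [eulerJ, qPochInf, hm]

theorem hasSum_mul_zero_pow (f : ℕ → ℂ) : HasSum (fun n => f n * 0 ^ n) (f 0) := by
  refine (hasSum_single 0 fun n hn => ?_).of_eq (fun _ => rfl) ?_
  · simp [hn]
  · simp

/-! ### Extraction of the four series. -/

theorem exists_primitiveRoot_eight : ∃ z : ℂ, z ^ 2 = Complex.I ∧ IsPrimitiveRoot z 8 := by
  obtain ⟨z, hz⟩ := IsAlgClosed.exists_pow_nat_eq Complex.I two_pos
  have h4 : z ^ 4 = -1 := by rw [show z ^ 4 = (z ^ 2) ^ 2 by ring, hz, Complex.I_sq]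
  refine ⟨z, hz, ?_⟩
  rw [show (8 : ℕ) = 2 ^ (2 + 1) by norm_num]
  have ho := orderOf_eq_prime_pow (x := z) (p := 2) (n := 2) (by norm_num [h4]) (by
    rw [show (2 : ℕ) ^ (2 + 1) = 4 * 2 by norm_num, pow_mul, h4]; norm_num)
  rw [← ho]
  exact IsPrimitiveRoot.orderOf z

/-- The four components of the eight-dissection, for nonzero `q`. -/
theorem hasSum_oddRankCount_components {q : ℂ} (hq0 : q ≠ 0) (hq : ‖q‖ < 1) :
    HasSum (fun n : ℕ =>
        ((oddRankCount 0 8 (8 * n + 1) : ℂ) - (oddRankCount 4 8 (8 * n + 1) : ℂ)) * q ^ n)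
      (eulerJ 2 q ^ 4 / (eulerJ 1 q ^ 2 * eulerJ 4 q)) ∧
    HasSum (fun n : ℕ =>
        ((oddRankCount 0 8 (8 * n + 3) : ℂ) - (oddRankCount 4 8 (8 * n + 3) : ℂ)) * q ^ n)
      (eulerJ 4 q ^ 3 / eulerJ 2 q ^ 2 + q * mockG (q ^ 2) (q ^ 4)) ∧
    HasSum (fun n : ℕ =>
        ((oddRankCount 1 8 (8 * n) : ℂ) - (oddRankCount 3 8 (8 * n) : ℂ)) * q ^ n)
      (q * mockG q (q ^ 4)) ∧
    HasSum (fun n : ℕ =>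
        ((oddRankCount 1 8 (8 * n + 2) : ℂ) - (oddRankCount 3 8 (8 * n + 2) : ℂ)) * q ^ n)
      (eulerJ 2 q * eulerJ 4 q / eulerJ 1 q) := by
  obtain ⟨z, hz, hzp⟩ := exists_primitiveRoot_eight
  have hz0 : z ≠ 0 := fun h => Complex.I_ne_zero (by rw [← hz, h]; ring)
  have hz1 : ‖z‖ = 1 := hzp.norm'_eq_one (by norm_num)
  obtain ⟨w, hw⟩ := IsAlgClosed.exists_pow_nat_eq q (n := 8) (by norm_num)
  have hw0 : w ≠ 0 := fun h => hq0 (by rw [← hw, h]; ring)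
  have hw1 : ‖w‖ < 1 := by
    rw [← hw, norm_pow] at hq
    exact lt_of_not_ge fun h => hq.not_ge (one_le_pow₀ h)
  have hk : z * (1 - Complex.I) ≠ 0 := mul_ne_zero hz0 fun h => by
    simpa using congrArg Complex.re h
  -- The dissection contains only the exponent classes `0, 1, 2, 3` modulo 8. Classes 0 and 2 carry
  -- the factor `z * (1 - I)`, which is divided out below.
  set c : ℕ → ℂ := fun s =>
    if s = 0 then z * (1 - Complex.I) * (q * mockG q (q ^ 4))
    else if s = 1 then eulerJ 2 q ^ 4 / (eulerJ 1 q ^ 2 * eulerJ 4 q)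
    else if s = 2 then z * (1 - Complex.I) * (eulerJ 2 q * eulerJ 4 q / eulerJ 1 q)
    else if s = 3 then eulerJ 4 q ^ 3 / eulerJ 2 q ^ 2 + q * mockG (q ^ 2) (q ^ 4)
    else 0 with hc
  have h : ∀ j, HasSum (fun n => (∑' s : OddDurfeeSymbol n, z ^ s.oddRank) * (z ^ j * w) ^ n)
      (∑ s ∈ Finset.range 8, c s * (z ^ j * w) ^ s) := by
    intro j
    have hj0 : z ^ j * w ≠ 0 := mul_ne_zero (pow_ne_zero j hz0) hw0
    have hj1 : ‖z ^ j * w‖ < 1 := by rwa [norm_mul, norm_pow, hz1, one_pow, one_mul]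
    have hj8 : (z ^ j * w) ^ 8 = q := by
      rw [mul_pow, ← pow_mul, mul_comm j, pow_mul, hzp.pow_eq_one, one_pow, one_mul, hw]
    refine (hasSum_oddRank hz1 hj0 hj1).of_eq (fun _ => rfl) ?_
    rw [mul_appellSum_eighth_root hz hj0 hj1, hj8]
    simp [Finset.sum_range_succ, hc]
    ring
  have key : ∀ r < 8, HasSum (fun m => (((oddRankCount 0 8 (8 * m + r) : ℂ)
      - oddRankCount 4 8 (8 * m + r)) + z * (1 - Complex.I) *
      ((oddRankCount 1 8 (8 * m + r) : ℂ) - oddRankCount 3 8 (8 * m + r))) * q ^ m) (c r) := by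
    intro r hr
    have := hasSum_residue_class hzp (by norm_num) hw0 h hr
    rw [hw] at this
    exact this.of_eq (fun m => by rw [tsum_eighth_root_oddRank hz]) rfl
  -- Parity separates the two differences: for odd residues the counts of odd rank vanish, for even
  -- residues those of even rank.
  have hodd : ∀ m r : ℕ, Odd r → oddRankCount 1 8 (8 * m + r) = 0 ∧
      oddRankCount 3 8 (8 * m + r) = 0 := by
    rintro m r ⟨b, rfl⟩
    exact ⟨oddRankCount_eq_zero ⟨4 * m + b + 1, by push_cast; ring⟩,
      oddRankCount_eq_zero ⟨4 * m + b + 2, by push_cast; ring⟩⟩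
  have heven : ∀ m r : ℕ, Even r → oddRankCount 0 8 (8 * m + r) = 0 ∧
      oddRankCount 4 8 (8 * m + r) = 0 := by
    rintro m r ⟨b, rfl⟩
    exact ⟨oddRankCount_eq_zero ⟨4 * m + b, by push_cast; ring⟩,
      oddRankCount_eq_zero ⟨4 * m + b + 2, by push_cast; ring⟩⟩
  have hI1 : 1 - Complex.I ≠ 0 := right_ne_zero_of_mul hk
  refine ⟨?_, ?_, ?_, ?_⟩
  · refine (key 1 (by norm_num)).of_eq (fun m => ?_) (by simp [hc])
    rw [(hodd m 1 (by decide)).1, (hodd m 1 (by decide)).2]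
    simp
  · refine (key 3 (by norm_num)).of_eq (fun m => ?_) (by simp [hc])
    rw [(hodd m 3 (by decide)).1, (hodd m 3 (by decide)).2]
    simp
  · refine ((key 0 (by norm_num)).div_const (z * (1 - Complex.I))).of_eq (fun m => ?_) ?_
    · rw [(heven m 0 (by decide)).1, (heven m 0 (by decide)).2, add_zero, Nat.cast_zero, sub_zero,
        zero_add]
      field_simp
    · simp only [hc, if_true]
      field_simp
  · refine ((key 2 (by norm_num)).div_const (z * (1 - Complex.I))).of_eq (fun m => ?_) ?_
    · rw [(heven m 2 (by decide)).1, (heven m 2 (by decide)).2, Nat.cast_zero, sub_zero,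
        zero_add]
      field_simp
    · simp only [hc, if_true, OfNat.ofNat_ne_zero, if_false, OfNat.ofNat_ne_one]
      field_simp

end

theorem mainTheorem7 (q : ℂ) (hq : ‖q‖ < 1) :
    HasSum (fun n : ℕ =>
        ((oddRankCount 0 8 (8 * n + 1) : ℂ) - (oddRankCount 4 8 (8 * n + 1) : ℂ)) * q ^ n)
      (eulerJ 2 q ^ 4 / (eulerJ 1 q ^ 2 * eulerJ 4 q)) ∧
    (q ≠ 0 → HasSum (fun n : ℕ =>
        ((oddRankCount 0 8 (8 * n + 3) : ℂ) - (oddRankCount 4 8 (8 * n + 3) : ℂ)) * q ^ n)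
      (eulerJ 4 q ^ 3 / eulerJ 2 q ^ 2 + q * mockG (q ^ 2) (q ^ 4))) ∧
    (q ≠ 0 → HasSum (fun n : ℕ =>
        ((oddRankCount 1 8 (8 * n) : ℂ) - (oddRankCount 3 8 (8 * n) : ℂ)) * q ^ n)
      (q * mockG q (q ^ 4))) ∧
    HasSum (fun n : ℕ =>
        ((oddRankCount 1 8 (8 * n + 2) : ℂ) - (oddRankCount 3 8 (8 * n + 2) : ℂ)) * q ^ n)
      (eulerJ 2 q * eulerJ 4 q / eulerJ 1 q) := by
  rcases eq_or_ne q 0 with rfl | hq0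
  -- At `q = 0` the expansions above are not available, but each series reduces to its term `n = 0`
  -- because `0 ^ 0 = 1`.
  · refine ⟨?_, fun h => absurd rfl h, fun h => absurd rfl h, ?_⟩
    · refine (hasSum_mul_zero_pow _).of_eq (fun _ => rfl) ?_
      simp [eulerJ_zero, oddRankCount_zero_one, oddRankCount_four_one]
    · refine (hasSum_mul_zero_pow _).of_eq (fun _ => rfl) ?_
      simp [eulerJ_zero, oddRankCount_one_two, oddRankCount_three_two]
  · obtain ⟨h1, h2, h3, h4⟩ := hasSum_oddRankCount_components hq0 hq
    exact ⟨h1, fun _ => h2, fun _ => h3, h4⟩
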